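/- Let $V=\mathbb R^4$ (the 1-forms of Minkowski spacetime, identified with spacetime by position forms) have basis $\gamma_0,\dots,\gamma_3$, scalar product $\gamma_\mu\cdot\gamma_\nu=\eta_{\mu\nu}=\mathrm{diag}(1,-1,-1,-1)$ and reciprocal basis $\gamma^\mu$. Let $\Lambda=\bigoplus_{p=0}^4\Lambda^p$ be its Clifford algebra, with exterior product $\wedge$, left contraction $\lrcorner$, commutator product $A\times B=\tfrac12(AB-BA)$ and scalar product $A\cdot B=\langle A\tilde B\rangle_0$. For a set of grades $S\subseteq\{0,\dots,4\}$ let $\langle A\rangle_S$ be the part of $A$ with grades in $S$, and $\Lambda^S=\{A:\langle A\rangle_S=A\}$. Let $U\subseteq V$ be open and let $h$ be a smooth field on $U$ of invertible linear maps $h_x:V\to V$ (gauge metric extensor field); put $h^\star=(h^{-1})^\dagger$, the adjoint being taken with respect to $\cdot$. Let $D_a$ be the Levi-Civita covariant derivative of the metric $g(a,b)=h(a)\cdot h(b)$, let $\mathcal D_a n=h(D_a h^{-1}(n))$ for 1-form fields $n$, let $\Omega(a)=-\tfrac12\sum_\nu\gamma^\nu\wedge\mathcal D_a\gamma_\nu$,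 and for smooth multiform fields $X:U\to\Lambda$ put $\mathcal D_aX=a\cdot\partial X+\Omega(a)\times X$ and $$\mathcal D\lrcorner X=\sum_\mu h^\star(\gamma^\mu)\lrcorner\mathcal D_{\gamma_\mu}X,\quad \mathcal D\wedge X=\sum_\mu h^\star(\gamma^\mu)\wedge\mathcal D_{\gamma_\mu}X,\quad \mathcal DX=\sum_\mu h^\star(\gamma^\mu)\,\mathcal D_{\gamma_\mu}X .$$ Let $X:U\to\Lambda^S$ be a smooth field, let $\mathcal D{*}X$ be one of $\mathcal D\lrcorner X$, $\mathcal D\wedge X$, $\mathcal DX$, and let $T$ be correspondingly the set of grades $S-1$, $S+1$ or $(S-1)\cup(S+1)$ (within $\{0,\dots,4\}$). Let $\ell$ be a real function of two multiform variables, of class $C^2$ near the points $(X(x),\mathcal D{*}X(x))$, $x\in U$. Let $\partial_X\ell$ and $\partial_{\mathcal D*X}\ell$ be its multiform derivatives at $(X,\mathcal D{*}X)$ with respect to the first and the second variable, that is, the partial gradients in $\Lambda^S$ and in $\Lambda^T$ with respect to the scalar product $\cdot$. Suppose that $\det(h)\,\ell(X,\mathcal D{*}X)$ is integrable on $U$ and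 that the action is stationary at $X$: for every smooth $A:V\to\Lambda^S$ with compact support contained in $U$, $$\frac{d}{d\lambda}\Big|_{\lambda=0}\int_U\det(h)\,\ell\big(X+\lambda A,\mathcal D{*}X+\lambda\,\mathcal D{*}A\big)\,d^4x=0 .$$ Then the following holds on $U$. (a) If $*$ is $\lrcorner$: $\ \partial_X\ell-\mathcal D\wedge\partial_{\mathcal D\lrcorner X}\ell=0$. (b) If $*$ is $\wedge$: $\ \partial_X\ell-\mathcal D\lrcorner\,\partial_{\mathcal D\wedge X}\ell=0$. (c) If $*$ is the Clifford product: $\ \langle\partial_X\ell-\mathcal D\,\partial_{\mathcal DX}\ell\rangle_S=0$; and $\ \partial_X\ell-\mathcal D\,\partial_{\mathcal DX}\ell=0$ whenever $S$ contains, with a grade $p$, all grades in $\{0,\dots,4\}$ of the same parity as $p$ (in particular for general, for even and for odd multiform fields). -/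

import Mathlib

open MeasureTheory
open scoped ContDiff

noncomputable section

namespace GaugeELE

/-- The Minkowski vector space of 1-forms; `a : Form1` has the components `a μ` in the
basis `γ_0, γ_1, γ_2, γ_3`. By means of position forms it also plays the role of spacetime, with
`volume` the measure `d⁴x`. -/
abbrev Form1 : Type := Fin 4 → ℝ

/-- The diagonal entries `η_{μμ} = η^{μμ}` of the Minkowski metric `diag(1, -1, -1, -1)`. -/
def eta (μ : Fin 4) : ℝ := if μ = 0 then 1 else -1

/-- The quadratic form `a ↦ a · a`. -/
def minkowskiQ : QuadraticForm ℝ Form1 := QuadraticMap.weightedSumSquares ℝ eta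

/-- The scalar product `(a, b) ↦ a · b` of 1-forms. -/
def dotForm : LinearMap.BilinForm ℝ Form1 := QuadraticMap.associated minkowskiQ

/-- The basis `γ_μ`. -/
def gammaLow (μ : Fin 4) : Form1 := Pi.single μ 1

/-- The reciprocal basis `γ^μ = η^{μν} γ_ν`. -/
def gammaUp (μ : Fin 4) : Form1 := eta μ • gammaLow μ

/-! ### Multiforms -/

/-- The spacetime algebra, whose elements are the multiforms. -/
abbrev Multiform : Type := CliffordAlgebra minkowskiQ

/-- The canonical linear isomorphism of the spacetime algebra with the exterior algebra. -/
def toExterior : Multiform ≃ₗ[ℝ] ExteriorAlgebra ℝ Form1 := CliffordAlgebra.equivExterior minkowskiQ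

/-- The basis of blades `γ_I = γ_{i₁} ∧ ⋯ ∧ γ_{iₖ}`, where `I = {i₁ < ⋯ < iₖ}`. -/
def blade : Module.Basis (Finset (Fin 4)) ℝ Multiform :=
  (Pi.basisFun ℝ (Fin 4)).ExteriorAlgebra.map toExterior.symm

/-- Multiforms form a 16-dimensional space; they are normed by their components in the
basis of blades (all norms are equivalent). -/
instance : NormedAddCommGroup Multiform :=
  NormedAddCommGroup.induced Multiform (Finset (Fin 4) → ℝ) blade.equivFun blade.equivFun.injective

instance : NormedSpace ℝ Multiform :=
  NormedSpace.induced ℝ Multiform (Finset (Fin 4) → ℝ) blade.equivFun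

/-- The reciprocal blades `γ^I = γ^{i₁} ∧ ⋯ ∧ γ^{iₖ}`. -/
def bladeUp (I : Finset (Fin 4)) : Multiform := (∏ i ∈ I, eta i) • blade I

/-- A 1-form as a multiform. -/
def ofForm1 : Form1 →ₗ[ℝ] Multiform := CliffordAlgebra.ι minkowskiQ

/-- The exterior product. -/
def wedge (X Y : Multiform) : Multiform := toExterior.symm (toExterior X * toExterior Y)

/-- The left contraction `a ⌟ X` of a multiform by a 1-form. -/
def contract (a : Form1) (X : Multiform) : Multiform := CliffordAlgebra.contractLeft (dotForm a) X

/-- The commutator product `X × Y = (XY - YX)/2`. -/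
def commutator (X Y : Multiform) : Multiform := (1 / 2 : ℝ) • (X * Y - Y * X)

/-- The part `⟨X⟩_S` of `X` with grades in `S`. -/
def gradePart (S : Finset ℕ) (X : Multiform) : Multiform :=
  ∑ I : Finset (Fin 4), if I.card ∈ S then blade.repr X I • blade I else 0

/-- The grades of `a ⌟ X` for `X` with grades in `S`. -/
def lowerGrades (S : Finset ℕ) : Finset ℕ := (Finset.range 5).filter fun p => p + 1 ∈ S

/-- The grades of `a ∧ X` for `X` with grades in `S`. -/
def raiseGrades (S : Finset ℕ) : Finset ℕ := (Finset.range 5).filter fun p => ∃ q ∈ S, p = q + 1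

/-- The multiform derivative `∂_X f` at `X` of a scalar function of a multiform variable with
grades in `S`: the multiform with grades in `S` such that `B · ∂_X f` is, for all `B` with grades
in `S`, the derivative of `f` at `X` in the direction `B`. Here `X · Y = ⟨X Ỹ⟩₀`, for which
`γ^I · γ_J = δ_{IJ}`. -/
def multiformDeriv (S : Finset ℕ) (f : Multiform → ℝ) (X : Multiform) : Multiform :=
  ∑ I : Finset (Fin 4), if I.card ∈ S then fderiv ℝ f X (blade I) • bladeUp I else 0

/-! ### The gauge covariant derivative -/

/-- The adjoint `t†` of a (1,1)-extensor: `t†(a) · b = a · t(b)`. -/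
def adj (t : Form1 →L[ℝ] Form1) (a : Form1) : Form1 := ∑ μ, dotForm a (t (gammaLow μ)) • gammaUp μ

/-- `h^⋆ = (h⁻¹)†`. -/
def hStar (h : Form1 → Form1 →L[ℝ] Form1) (x a : Form1) : Form1 := adj (h x).inverse a

/-- The metric `g(a, b) = h(a) · h(b)` at `x`. -/
def gaugeMetric (h : Form1 → Form1 →L[ℝ] Form1) (x a b : Form1) : ℝ := dotForm (h x a) (h x b)

/-- The Christoffel symbols of the metric `g`: the 1-form `Γ(a, b)` with
`g(Γ(a, b), c) = (a·∂ g(b, c) + b·∂ g(a, c) - c·∂ g(a, b)) / 2` for all constant `c`.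
(The 1-forms `h⁻¹(h^⋆(γ^μ))` are the `g`-reciprocals of the `γ_μ`.) -/
def christoffel (h : Form1 → Form1 →L[ℝ] Form1) (x a b : Form1) : Form1 :=
  (1 / 2 : ℝ) • ∑ μ,
    (fderiv ℝ (fun y => gaugeMetric h y b (gammaLow μ)) x a
      + fderiv ℝ (fun y => gaugeMetric h y a (gammaLow μ)) x b
      - fderiv ℝ (fun y => gaugeMetric h y a b) x (gammaLow μ))
    • (h x).inverse (hStar h x (gammaUp μ))

/-- The Levi-Civita directional covariant derivative `D_a Y` of the metric `g`, on 1-form fields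
(identified with vector fields by means of the Minkowski metric). -/
def leviCivita (h : Form1 → Form1 →L[ℝ] Form1) (a : Form1) (Y : Form1 → Form1) (x : Form1) :
    Form1 :=
  fderiv ℝ Y x a + christoffel h x a (Y x)

/-- The gauge covariant derivative `h(D_a h⁻¹(n))` of a 1-form field `n`. -/
def gaugeDerivForm1 (h : Form1 → Form1 →L[ℝ] Form1) (a : Form1) (n : Form1 → Form1) (x : Form1) :
    Form1 :=
  h x (leviCivita h a (fun y => (h y).inverse (n y)) x)

/-- The second connection extensor field `Ω(a) = -(1/2) ∂_n ∧ 𝒟_a n`. -/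
def Omega (h : Form1 → Form1 →L[ℝ] Form1) (x a : Form1) : Multiform :=
  (-(1 / 2) : ℝ) • ∑ ν,
    wedge (ofForm1 (gammaUp ν)) (ofForm1 (gaugeDerivForm1 h a (fun _ => gammaLow ν) x))

/-- The gauge covariant derivative `𝒟_a X = a·∂X + Ω(a) × X` of a multiform field. -/
def gaugeDeriv (h : Form1 → Form1 →L[ℝ] Form1) (a : Form1) (X : Form1 → Multiform) (x : Form1) :
    Multiform :=
  fderiv ℝ X x a + commutator (Omega h x a) (X x)

/-- The `h`-divergence `𝒟 ⌟ X = h^⋆(∂_a) ⌟ 𝒟_a X`. -/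
def hDiv (h : Form1 → Form1 →L[ℝ] Form1) (X : Form1 → Multiform) (x : Form1) : Multiform :=
  ∑ μ, contract (hStar h x (gammaUp μ)) (gaugeDeriv h (gammaLow μ) X x)

/-- The `h`-curl `𝒟 ∧ X = h^⋆(∂_a) ∧ 𝒟_a X`. -/
def hCurl (h : Form1 → Form1 →L[ℝ] Form1) (X : Form1 → Multiform) (x : Form1) : Multiform :=
  ∑ μ, wedge (ofForm1 (hStar h x (gammaUp μ))) (gaugeDeriv h (gammaLow μ) X x)

/-- The `h`-gradient `𝒟X = h^⋆(∂_a) 𝒟_a X`. -/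
def hGrad (h : Form1 → Form1 →L[ℝ] Form1) (X : Form1 → Multiform) (x : Form1) : Multiform :=
  ∑ μ, ofForm1 (hStar h x (gammaUp μ)) * gaugeDeriv h (gammaLow μ) X x

/-! ### Action -/

/-- The Lagrangian scalar field `det(h) ℓ(X, 𝒟*X)`; `Dstar` is one of `hDiv h`, `hCurl h`,
`hGrad h`. -/
def lagrangian (h : Form1 → Form1 →L[ℝ] Form1) (Dstar : (Form1 → Multiform) → Form1 → Multiform)
    (l : Multiform × Multiform → ℝ) (X : Form1 → Multiform) (x : Form1) : ℝ :=
  (h x).det * l (X x, Dstar X x)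

/-- The action `∫_U det(h) ℓ(X, 𝒟*X) d⁴x`. -/
def action (U : Set Form1) (h : Form1 → Form1 →L[ℝ] Form1)
    (Dstar : (Form1 → Multiform) → Form1 → Multiform)
    (l : Multiform × Multiform → ℝ) (X : Form1 → Multiform) : ℝ :=
  ∫ x in U, lagrangian h Dstar l X x

/-- The condition of stationary action for fields with grades in `S`: the action of `X` on `U` is
a convergent integral, and `S'(0) = 0` for the varied action `S(t)` of `X + tA`, for all smooth
`A` with grades in `S` and compact support inside `U`. -/
def IsStationary (S : Finset ℕ) (U : Set Form1) (h : Form1 → Form1 →L[ℝ] Form1)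
    (Dstar : (Form1 → Multiform) → Form1 → Multiform)
    (l : Multiform × Multiform → ℝ) (X : Form1 → Multiform) : Prop :=
  IntegrableOn (lagrangian h Dstar l X) U ∧
  ∀ A : Form1 → Multiform, ContDiff ℝ ∞ A → (∀ x, gradePart S (A x) = A x) →
    HasCompactSupport A → tsupport A ⊆ U →
    HasDerivAt (fun t : ℝ => action U h Dstar l (X + t • A)) 0 0

/-- `∂_X ℓ(X, 𝒟*X)` as a multiform field. -/
def derivFst (S : Finset ℕ) (Dstar : (Form1 → Multiform) → Form1 → Multiform)
    (l : Multiform × Multiform → ℝ) (X : Form1 → Multiform) (x : Form1) : Multiform :=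
  multiformDeriv S (fun Z => l (Z, Dstar X x)) (X x)

/-- `∂_{𝒟*X} ℓ(X, 𝒟*X)` as a multiform field, where `T` is the set of grades of `𝒟*X`. -/
def derivSnd (T : Finset ℕ) (Dstar : (Form1 → Multiform) → Form1 → Multiform)
    (l : Multiform × Multiform → ℝ) (X : Form1 → Multiform) (x : Form1) : Multiform :=
  multiformDeriv T (fun Z => l (X x, Z)) (Dstar X x)

end GaugeELE

end

open GaugeELE

noncomputable section

namespace GaugeELE

/-!
The operators `𝒟⌟`, `𝒟∧` and `𝒟` are all of the form `𝒟*X = ∑ μ, h^⋆(γ^μ) ∗ 𝒟_{γ_μ} X` for a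
bilinear product `∗` of 1-forms and multiforms, and the three Euler–Lagrange equations have one
proof.

* Contraction and exterior multiplication by a 1-form are adjoint for the scalar product, and
  Clifford multiplication is their sum, hence self-adjoint. All three products are equivariant
  under infinitesimal Lorentz transformations, which act on multiforms by the commutator product
  with a bivector.
* The connection `v ↦ 𝒟_a v` on constant 1-forms is skew for the Minkowski product because `D` is
  metric, so `Ω(a) ×` is the derivation extending it, and `𝒟_a` satisfies the Leibniz rule for the
  scalar product and for `∗`.
* Since `D` is torsion free, the frame `det(h) h^⋆(γ^μ)` is covariantly divergence free. Hence,
  if `∗'` is the adjoint product, `det(h) (𝒟*A · Y + A · 𝒟*'Y)` is the divergence of the current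
  `det(h) A · (h^⋆(γ^μ) ∗' Y)` and integrates to zero for compactly supported `A`.

The first variation of the action is therefore `∫ det(h) A · (∂_X ℓ - 𝒟*' ∂_{𝒟*X} ℓ)`, and the
fundamental lemma of the calculus of variations applies on each blade with grade in `S`.
-/

/-! ### Calculus in finite-dimensional spaces -/

theorem hasDerivAt_det_one_add_smul {𝕜 E : Type*} [NontriviallyNormedField 𝕜]
    [NormedAddCommGroup E] [NormedSpace 𝕜 E] [FiniteDimensional 𝕜 E] (K : E →L[𝕜] E) :
    HasDerivAt (fun t : 𝕜 => (1 + t • K).det) (LinearMap.trace 𝕜 E K) 0 := by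
  let b := Module.finBasis 𝕜 E
  set M := LinearMap.toMatrix b b (K : E →ₗ[𝕜] E) with hM
  let p := (Matrix.det (1 + (Polynomial.X : Polynomial 𝕜) • M.map Polynomial.C)).divX.divX
  have det_eq : ∀ t : 𝕜, (1 + t • K).det = 1 + M.trace * t + p.eval t * t ^ 2 := by
    intro t
    rw [← Matrix.det_one_add_smul, ContinuousLinearMap.det, ← LinearMap.det_toMatrix b]
    simp [hM, ContinuousLinearMap.toLinearMap_one, LinearMap.toMatrix_one]
  have hasDerivAt_poly := (((hasDerivAt_id (0 : 𝕜)).const_mul M.trace).const_add 1).add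
    ((p.hasDerivAt 0).mul ((hasDerivAt_id (0 : 𝕜)).pow 2))
  simp only [det_eq, LinearMap.trace_eq_matrix_trace 𝕜 b, ← hM]
  convert! hasDerivAt_poly using 1
  simp

section FiniteDimensional

variable {𝕜 : Type*} [NontriviallyNormedField 𝕜] [CompleteSpace 𝕜]
  {E F G H : Type*} [NormedAddCommGroup E] [NormedSpace 𝕜 E] [FiniteDimensional 𝕜 E]
  [NormedAddCommGroup F] [NormedSpace 𝕜 F] [FiniteDimensional 𝕜 F]
  [NormedAddCommGroup G] [NormedSpace 𝕜 G] [NormedAddCommGroup H] [NormedSpace 𝕜 H]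
  {n : WithTop ℕ∞} {u : H → E} {v : H → F} {x : H}

theorem contDiffAt_linear (f : E →ₗ[𝕜] G) (hu : ContDiffAt 𝕜 n u x) :
    ContDiffAt 𝕜 n (fun y => f (u y)) x :=
  (LinearMap.toContinuousLinearMap f).contDiff.contDiffAt.comp x hu

theorem fderiv_linear_apply (f : E →ₗ[𝕜] G) (hu : DifferentiableAt 𝕜 u x) (a : H) :
    fderiv 𝕜 (fun y => f (u y)) x a = f (fderiv 𝕜 u x a) := by
  have h := (LinearMap.toContinuousLinearMap f).hasFDerivAt.comp x hu.hasFDerivAt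
  exact DFunLike.congr_fun h.fderiv a

theorem contDiffAt_bilinear (f : E →ₗ[𝕜] F →ₗ[𝕜] G) (hu : ContDiffAt 𝕜 n u x)
    (hv : ContDiffAt 𝕜 n v x) : ContDiffAt 𝕜 n (fun y => f (u y) (v y)) x :=
  f.toContinuousBilinearMap.isBoundedBilinearMap.contDiff.contDiffAt.comp x (hu.prodMk hv)

theorem differentiableAt_bilinear (f : E →ₗ[𝕜] F →ₗ[𝕜] G) (hu : DifferentiableAt 𝕜 u x)
    (hv : DifferentiableAt 𝕜 v x) : DifferentiableAt 𝕜 (fun y => f (u y) (v y)) x :=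
  (f.toContinuousBilinearMap.hasFDerivAt_of_bilinear hu.hasFDerivAt hv.hasFDerivAt).differentiableAt

theorem fderiv_bilinear_apply (f : E →ₗ[𝕜] F →ₗ[𝕜] G) (hu : DifferentiableAt 𝕜 u x)
    (hv : DifferentiableAt 𝕜 v x) (a : H) :
    fderiv 𝕜 (fun y => f (u y) (v y)) x a =
      f (fderiv 𝕜 u x a) (v x) + f (u x) (fderiv 𝕜 v x a) := by
  refine (DFunLike.congr_fun (f.toContinuousBilinearMap.fderiv_of_bilinear hu hv) a).trans ?_
  rw [add_comm]
  rfl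

theorem fderiv_apply_mem_of_eventually_mem {p : Submodule 𝕜 E} (hu : DifferentiableAt 𝕜 u x)
    (hp : ∀ᶠ y in nhds x, u y ∈ p) (a : H) : fderiv 𝕜 u x a ∈ p := by
  refine (Subspace.forall_mem_dualAnnihilator_apply_eq_zero_iff p _).1 fun φ hφ => ?_
  have eventually_zero : (fun y => φ (u y)) =ᶠ[nhds x] fun _ => 0 :=
    hp.mono fun y hy => (Submodule.mem_dualAnnihilator φ).1 hφ _ hy
  rw [← fderiv_linear_apply φ hu, eventually_zero.fderiv_eq, fderiv_fun_const]
  rfl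

theorem contDiff_det : ContDiff 𝕜 n fun A : E →L[𝕜] E => A.det := by
  let b := Module.finBasis 𝕜 E
  have det_eq : ∀ A : E →L[𝕜] E, A.det =
      ∑ σ : Equiv.Perm _, ((Equiv.Perm.sign σ : ℤ) : 𝕜) * ∏ i, b.coord (σ i) (A (b i)) := by
    intro A
    rw [ContinuousLinearMap.det, ← LinearMap.det_toMatrix b, Matrix.det_apply']
    simp only [LinearMap.toMatrix_apply, Module.Basis.coord_apply, ContinuousLinearMap.coe_coe]
  simp only [det_eq]
  refine ContDiff.sum fun σ _ => contDiff_const.mul (contDiff_prod fun i _ => ?_)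
  exact contDiff_iff_contDiffAt.2 fun A =>
    contDiffAt_linear _ (contDiffAt_id.clm_apply contDiffAt_const)

theorem contDiffAt_det {f : H → E →L[𝕜] E} (hf : ContDiffAt 𝕜 n f x) :
    ContDiffAt 𝕜 n (fun y => (f y).det) x :=
  contDiff_det.contDiffAt.comp x hf

theorem fderiv_det_apply {A : E →L[𝕜] E} (hA : A.IsInvertible) (K : E →L[𝕜] E) :
    fderiv 𝕜 (fun A : E →L[𝕜] E => A.det) A K =
      A.det * LinearMap.trace 𝕜 E (A.inverse ∘L K : E →L[𝕜] E) := by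
  have factor : ∀ t : 𝕜, (A + t • K).det = A.det * (1 + t • (A.inverse ∘L K)).det := by
    intro t
    have : A + t • K = A ∘L (1 + t • (A.inverse ∘L K)) := by
      ext v
      simp [hA.self_apply_inverse]
    rw [this]
    exact LinearMap.det_comp _ _
  have hasDerivAt_line : HasDerivAt (fun t : 𝕜 => A + t • K) K 0 := by
    simpa using ((hasDerivAt_id (0 : 𝕜)).smul_const K).const_add A
  have hasFDerivAt_det := ((contDiff_det (n := 1)).differentiable (by simp) A).hasFDerivAt
  rw [← add_zero A, ← zero_smul 𝕜 K] at hasFDerivAt_det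
  have hasDerivAt_det := hasFDerivAt_det.comp_hasDerivAt (0 : 𝕜) hasDerivAt_line
  rw [zero_smul, add_zero] at hasDerivAt_det
  exact hasDerivAt_det.unique
    (((hasDerivAt_det_one_add_smul (A.inverse ∘L K)).const_mul A.det).congr_of_eventuallyEq
      (Filter.Eventually.of_forall factor))

end FiniteDimensional

section NormedSpace

variable {𝕜 : Type*} [NontriviallyNormedField 𝕜]
  {E F G : Type*} [NormedAddCommGroup E] [NormedSpace 𝕜 E] [NormedAddCommGroup F]
  [NormedSpace 𝕜 F] [NormedAddCommGroup G] [NormedSpace 𝕜 G]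

theorem det_ne_zero_of_isInvertible {A : E →L[𝕜] E} (hA : A.IsInvertible) : A.det ≠ 0 := by
  obtain ⟨e, rfl⟩ := hA
  exact e.toLinearEquiv.isUnit_det'.ne_zero

theorem eventually_isInvertible [CompleteSpace E] {α : Type*} [TopologicalSpace α]
    {f : α → E →L[𝕜] F} {x : α} (hf : ContinuousAt f x) (hx : (f x).IsInvertible) :
    ∀ᶠ y in nhds x, (f y).IsInvertible := by
  obtain ⟨e, he⟩ := hx
  have range_mem := e.nhds
  rw [he] at range_mem
  exact hf range_mem

section Inverse

variable [CompleteSpace E] {f : G → E →L[𝕜] F} {x : G}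

theorem contDiffAt_inverse {n : WithTop ℕ∞} (hf : ContDiffAt 𝕜 n f x) (hi : (f x).IsInvertible) :
    ContDiffAt 𝕜 n (fun y => (f y).inverse) x :=
  hi.contDiffAt_map_inverse.comp x hf

theorem differentiableAt_inverse_apply (hf : DifferentiableAt 𝕜 f x) (hi : (f x).IsInvertible)
    (v : F) : DifferentiableAt 𝕜 (fun y => (f y).inverse v) x := by
  have inverse_differentiable : DifferentiableAt 𝕜
      (ContinuousLinearMap.inverse : (E →L[𝕜] F) → F →L[𝕜] E) (f x) :=
    (hi.contDiffAt_map_inverse (n := 1)).differentiableAt one_ne_zero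
  exact (inverse_differentiable.comp x hf).clm_apply (differentiableAt_const v)

theorem apply_fderiv_inverse_apply (hf : DifferentiableAt 𝕜 f x) (hi : (f x).IsInvertible)
    (a : G) (v : F) :
    f x (fderiv 𝕜 (fun y => (f y).inverse v) x a) = -fderiv 𝕜 f x a ((f x).inverse v) := by
  have self_apply_inverse : (fun y => f y ((f y).inverse v)) =ᶠ[nhds x] fun _ => v :=
    (eventually_isInvertible hf.continuousAt hi).mono fun y hy => hy.self_apply_inverse v
  have product_rule := self_apply_inverse.fderiv_eq (𝕜 := 𝕜)
  rw [fderiv_clm_apply hf (differentiableAt_inverse_apply hf hi v), fderiv_fun_const]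
    at product_rule
  exact eq_neg_of_add_eq_zero_left (DFunLike.congr_fun product_rule a)

end Inverse

theorem fderiv_apply_prod {l : E × F → G} {u : E} {v : F} (hl : DifferentiableAt 𝕜 l (u, v))
    (a : E) (b : F) :
    fderiv 𝕜 l (u, v) (a, b) =
      fderiv 𝕜 (fun z => l (z, v)) u a + fderiv 𝕜 (fun z => l (u, z)) v b := by
  have fst := hl.hasFDerivAt.comp u (hasFDerivAt_prodMk_left (𝕜 := 𝕜) u v)
  have snd := hl.hasFDerivAt.comp v (hasFDerivAt_prodMk_right (𝕜 := 𝕜) u v)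
  have sum : (a, b) = ContinuousLinearMap.inl 𝕜 E F a + ContinuousLinearMap.inr 𝕜 E F b := by
    simp
  rw [sum, map_add]
  exact (congrArg₂ (· + ·) (DFunLike.congr_fun fst.fderiv a)
    (DFunLike.congr_fun snd.fderiv b)).symm

end NormedSpace

/-! ### Calculus of variations -/

theorem contDiff_of_forall_mem_of_forall_notMem {𝕜 E F : Type*} [NontriviallyNormedField 𝕜]
    [NormedAddCommGroup E] [NormedSpace 𝕜 E] [NormedAddCommGroup F] [NormedSpace 𝕜 F]
    {n : WithTop ℕ∞} {f : E → F} {K : Set E} (hK : IsClosed K)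
    (hf : ∀ x ∈ K, ContDiffAt 𝕜 n f x) (hf0 : ∀ x ∉ K, f x = 0) : ContDiff 𝕜 n f := by
  refine contDiff_iff_contDiffAt.2 fun x => ?_
  by_cases hx : x ∈ K
  · exact hf x hx
  · have eventually_zero : f =ᶠ[nhds x] fun _ => 0 :=
      (hK.isOpen_compl.eventually_mem hx).mono hf0
    exact contDiffAt_const.congr_of_eventuallyEq eventually_zero

section AddHaar

variable {E F : Type*} [NormedAddCommGroup E] [NormedSpace ℝ E] [MeasurableSpace E]
  [BorelSpace E] [NormedAddCommGroup F] [NormedSpace ℝ F] {μ : Measure E}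

theorem integrable_fderiv_apply [IsFiniteMeasureOnCompacts μ] {f : E → F}
    (hf : ContDiff ℝ 1 f) (hc : HasCompactSupport f) (v : E) :
    Integrable (fun x => fderiv ℝ f x v) μ :=
  ((hf.continuous_fderiv one_ne_zero).clm_apply continuous_const).integrable_of_hasCompactSupport
    (hc.fderiv_apply ℝ v)

variable [FiniteDimensional ℝ E] [μ.IsAddHaarMeasure]

theorem integral_fderiv_apply_eq_zero {f : E → F} (hf : ContDiff ℝ 1 f)
    (hc : HasCompactSupport f) (v : E) : ∫ x, fderiv ℝ f x v ∂μ = 0 := by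
  simpa using integral_smul_fderiv_eq_neg_fderiv_smul_of_integrable (𝕜 := ℝ) (μ := μ)
    (f := fun _ => 1) (g := f) (v := v) (by simp) (by simpa using integrable_fderiv_apply hf hc v)
    (by simpa using hf.continuous.integrable_of_hasCompactSupport hc)
    (fun x _ => differentiableAt_const 1) (fun x _ => hf.differentiable one_ne_zero x)

theorem eqOn_zero_of_forall_integral_smul_eq_zero [CompleteSpace F] {U : Set E}
    (hU : IsOpen U) {f : E → F} (hf : ContinuousOn f U)
    (h : ∀ φ : E → ℝ, ContDiff ℝ ∞ φ → HasCompactSupport φ → tsupport φ ⊆ U →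
      ∫ x, φ x • f x ∂μ = 0) : Set.EqOn f 0 U :=
  Measure.eqOn_open_of_ae_eq ((ae_restrict_iff' hU.measurableSet).2
    (hU.ae_eq_zero_of_integral_contDiff_smul_eq_zero
      (hf.locallyIntegrableOn hU.measurableSet) h)) hU hf continuousOn_const

end AddHaar

theorem hasDerivAt_setIntegral_of_forall_diff_eq {α G : Type*} [MeasurableSpace α]
    {μ : Measure α} [NormedAddCommGroup G] [NormedSpace ℝ G] {U K : Set α}
    (hU : MeasurableSet U) (hK : MeasurableSet K) (hKU : K ⊆ U)
    {F : ℝ → α → G} {t₀ : ℝ} {d : G} (hF : ∀ t, ∀ x ∈ U \ K, F t x = F t₀ x)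
    (hU_int : IntegrableOn (F t₀) U μ) (hK_int : ∀ᶠ t in nhds t₀, IntegrableOn (F t) K μ)
    (hd : HasDerivAt (fun t => ∫ x in K, F t x ∂μ) d t₀) :
    HasDerivAt (fun t => ∫ x in U, F t x ∂μ) d t₀ := by
  have split : (fun t => ∫ x in U, F t x ∂μ) =ᶠ[nhds t₀]
      fun t => ∫ x in K, F t x ∂μ + ∫ x in U \ K, F t₀ x ∂μ := by
    filter_upwards [hK_int] with t ht
    have int_diff : IntegrableOn (F t) (U \ K) μ :=
      (hU_int.mono_set Set.sdiff_subset).congr_fun (fun x hx => (hF t x hx).symm) (hU.diff hK)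
    rw [← setIntegral_congr_fun (hU.diff hK) (hF t),
      ← setIntegral_union Set.disjoint_sdiff_right (hU.diff hK) ht int_diff,
      Set.union_sdiff_cancel hKU]
  exact (hd.add_const _).congr_of_eventuallyEq split

section LineVariation

variable {α V W : Type*} [TopologicalSpace α] [NormedAddCommGroup V] [NormedSpace ℝ V]
  [NormedAddCommGroup W] [NormedSpace ℝ W] {K : Set α} {w : α → ℝ} {p q : α → V} {l : V → W}

theorem eventually_forall_mem_contDiffAt_add_smul {Q : Set (V × V)}
    (hQ : IsCompact Q) (hl : ∀ z ∈ Q, ContDiffAt ℝ 1 l z.1) :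
    ∀ᶠ t in nhds (0 : ℝ), ∀ z ∈ Q, ContDiffAt ℝ 1 l (z.1 + t • z.2) := by
  refine hQ.eventually_forall_of_forall_eventually fun z hz => ?_
  have tendsto_point : Filter.Tendsto (fun y : ℝ × V × V => y.2.1 + y.1 • y.2.2)
      (nhds (0, z)) (nhds z.1) := by
    have : Continuous fun y : ℝ × V × V => y.2.1 + y.1 • y.2.2 := by fun_prop
    simpa using this.tendsto (0, z)
  exact tendsto_point ((hl z hz).eventually (by simp))

theorem eventually_forall_mem_contDiffAt_comp_add_smul (hK : IsCompact K)
    (hp : ContinuousOn p K) (hq : ContinuousOn q K) (hl : ∀ x ∈ K, ContDiffAt ℝ 1 l (p x)) :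
    ∀ᶠ t in nhds (0 : ℝ), ∀ x ∈ K, ContDiffAt ℝ 1 l (p x + t • q x) :=
  (eventually_forall_mem_contDiffAt_add_smul (hK.image_of_continuousOn (hp.prodMk hq))
    (Set.forall_mem_image.2 hl)).mono fun _ ht => fun _ hx => ht _ (Set.mem_image_of_mem _ hx)

theorem continuousOn_smul_comp_add_smul {t : ℝ} (hw : ContinuousOn w K) (hp : ContinuousOn p K)
    (hq : ContinuousOn q K) (hl : ∀ x ∈ K, ContDiffAt ℝ 1 l (p x + t • q x)) :
    ContinuousOn (fun x => w x • l (p x + t • q x)) K := by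
  refine hw.smul fun x hx => ?_
  exact ((hl x hx).continuousAt.comp_continuousWithinAt (f := fun x => p x + t • q x))
    ((hp.add (hq.const_smul t)) x hx)

variable [T2Space α] [MeasurableSpace α] [OpensMeasurableSpace α] {μ : Measure α}
  [IsFiniteMeasureOnCompacts μ]

theorem hasDerivAt_setIntegral_smul_comp_add_smul (hK : IsCompact K) (hw : ContinuousOn w K)
    (hp : ContinuousOn p K) (hq : ContinuousOn q K) (hl : ∀ x ∈ K, ContDiffAt ℝ 1 l (p x)) :
    HasDerivAt (fun t : ℝ => ∫ x in K, w x • l (p x + t • q x) ∂μ)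
      (∫ x in K, w x • fderiv ℝ l (p x) (q x) ∂μ) 0 := by
  have contDiff_near := eventually_forall_mem_contDiffAt_comp_add_smul hK hp hq hl
  obtain ⟨r, hr, hl_r⟩ := Metric.nhds_basis_closedBall.mem_iff.1 contDiff_near
  have snd_mapsTo : Set.MapsTo Prod.snd (Metric.closedBall (0 : ℝ) r ×ˢ K) K := fun z hz => hz.2
  have continuousOn_deriv : ContinuousOn
      (fun z : ℝ × α => w z.2 • fderiv ℝ l (p z.2 + z.1 • q z.2) (q z.2))
      (Metric.closedBall 0 r ×ˢ K) := by
    have hp' := hp.comp continuousOn_snd snd_mapsTo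
    have hq' := hq.comp continuousOn_snd snd_mapsTo
    refine (hw.comp continuousOn_snd snd_mapsTo).smul (ContinuousOn.clm_apply (fun z hz => ?_) hq')
    exact ((hl_r hz.1 z.2 hz.2).continuousAt_fderiv one_ne_zero).comp_continuousWithinAt
      (f := fun z : ℝ × α => p z.2 + z.1 • q z.2) ((hp'.add (continuousOn_fst.smul hq')) z hz)
  obtain ⟨C, hC⟩ :=
    ((isCompact_closedBall (0 : ℝ) r).prod hK).exists_bound_of_continuousOn continuousOn_deriv
  have hasDerivAt_integrand : ∀ x ∈ K, ∀ t ∈ Metric.ball (0 : ℝ) r,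
      HasDerivAt (fun t : ℝ => w x • l (p x + t • q x))
        (w x • fderiv ℝ l (p x + t • q x) (q x)) t := by
    intro x hx t ht
    have line : HasDerivAt (fun t : ℝ => p x + t • q x) (q x) t := by
      simpa using ((hasDerivAt_id t).smul_const (q x)).const_add (p x)
    have hl_t := (hl_r (Metric.ball_subset_closedBall ht) x hx).differentiableAt one_ne_zero
    exact (hl_t.hasFDerivAt.comp_hasDerivAt t line).const_smul (w x)
  have key := hasDerivAt_integral_of_dominated_loc_of_deriv_le (μ := μ.restrict K) (x₀ := (0 : ℝ))
    (F := fun t x => w x • l (p x + t • q x))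
    (F' := fun t x => w x • fderiv ℝ l (p x + t • q x) (q x)) (bound := fun _ => C)
    (Metric.ball_mem_nhds 0 hr)
    (contDiff_near.mono fun t ht =>
      ((continuousOn_smul_comp_add_smul hw hp hq ht).integrableOn_compact hK).aestronglyMeasurable)
    ((continuousOn_smul_comp_add_smul hw hp hq contDiff_near.self_of_nhds).integrableOn_compact hK)
    ((continuousOn_deriv.comp (f := fun x => ((0 : ℝ), x)) (by fun_prop) fun x hx =>
      ⟨Metric.mem_closedBall_self hr.le, hx⟩).integrableOn_compact hK).aestronglyMeasurable
    ((ae_restrict_mem hK.measurableSet).mono fun x hx t ht =>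
      hC (t, x) ⟨Metric.ball_subset_closedBall ht, hx⟩)
    (continuousOn_const.integrableOn_compact hK)
    ((ae_restrict_mem hK.measurableSet).mono hasDerivAt_integrand)
  simpa using key.2

theorem hasDerivAt_setIntegral_smul_comp_add_smul_of_subset {U : Set α} (hU : MeasurableSet U)
    (hK : IsCompact K) (hKU : K ⊆ U) (hw : ContinuousOn w K) (hp : ContinuousOn p K)
    (hq : ContinuousOn q K) (hqK : ∀ x ∉ K, q x = 0) (hl : ∀ x ∈ K, ContDiffAt ℝ 1 l (p x))
    (hl_int : IntegrableOn (fun x => w x • l (p x)) U μ) :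
    HasDerivAt (fun t : ℝ => ∫ x in U, w x • l (p x + t • q x) ∂μ)
      (∫ x in K, w x • fderiv ℝ l (p x) (q x) ∂μ) 0 := by
  refine hasDerivAt_setIntegral_of_forall_diff_eq hU hK.measurableSet hKU
    (F := fun t x => w x • l (p x + t • q x)) (fun t x hx => ?_) (by simpa using hl_int)
    ((eventually_forall_mem_contDiffAt_comp_add_smul hK hp hq hl).mono fun t ht =>
      (continuousOn_smul_comp_add_smul hw hp hq ht).integrableOn_compact hK)
    (hasDerivAt_setIntegral_smul_comp_add_smul hK hw hp hq hl)
  simp only [hqK x hx.2, smul_zero]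

end LineVariation

instance : FiniteDimensional ℝ Multiform := blade.finiteDimensional_of_finite

/-! ### The Minkowski scalar product -/

theorem eta_mul_self (μ : Fin 4) : eta μ * eta μ = 1 := by
  unfold eta; split_ifs <;> norm_num

theorem dotForm_apply (a b : Form1) : dotForm a b = ∑ μ, eta μ * (a μ * b μ) := by
  simp only [dotForm, minkowskiQ, QuadraticMap.associated_apply,
    QuadraticMap.weightedSumSquares_apply, Pi.add_apply, smul_eq_mul, ← Finset.sum_sub_distrib,
    Finset.smul_sum, Module.End.smul_def]
  refine Finset.sum_congr rfl fun μ _ => ?_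
  norm_num
  ring

theorem dotForm_comm (a b : Form1) : dotForm a b = dotForm b a := by
  simp only [dotForm_apply, mul_comm (a _)]

theorem dotForm_gammaLow (μ : Fin 4) (a : Form1) : dotForm (gammaLow μ) a = eta μ * a μ := by
  simp [dotForm_apply, gammaLow, Pi.single_apply]

theorem dotForm_gammaUp (μ : Fin 4) (a : Form1) : dotForm (gammaUp μ) a = a μ := by
  rw [gammaUp, map_smul, LinearMap.smul_apply, dotForm_gammaLow, smul_eq_mul, ← mul_assoc,
    eta_mul_self, one_mul]

theorem eq_of_forall_dotForm_eq {a b : Form1} (h : ∀ c, dotForm a c = dotForm b c) : a = b := by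
  ext μ
  rw [← dotForm_gammaUp μ a, ← dotForm_gammaUp μ b, dotForm_comm, h, dotForm_comm]

theorem sum_smul_gammaLow (a : Form1) : ∑ μ, a μ • gammaLow μ = a := by
  ext ν
  simp [gammaLow, Finset.sum_apply, Pi.single_apply]

theorem sum_dotForm_smul_gammaUp (a : Form1) : ∑ μ, dotForm a (gammaLow μ) • gammaUp μ = a := by
  conv_rhs => rw [← sum_smul_gammaLow a]
  refine Finset.sum_congr rfl fun μ _ => ?_
  rw [dotForm_comm, dotForm_gammaLow, gammaUp, smul_smul, mul_right_comm, eta_mul_self, one_mul]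

theorem sum_dotForm_smul_apply_gammaUp {M : Type*} [AddCommGroup M] [Module ℝ M]
    (f : Form1 →ₗ[ℝ] M) (a : Form1) : ∑ μ, dotForm a (gammaLow μ) • f (gammaUp μ) = f a := by
  conv_rhs => rw [← sum_dotForm_smul_gammaUp a, map_sum]
  simp only [map_smul]

theorem sum_dotForm_gammaUp_smul_apply_gammaLow {M : Type*} [AddCommGroup M] [Module ℝ M]
    (f : Form1 →ₗ[ℝ] M) (a : Form1) : ∑ μ, dotForm (gammaUp μ) a • f (gammaLow μ) = f a := by
  conv_rhs => rw [← sum_smul_gammaLow a, map_sum]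
  simp only [map_smul, dotForm_gammaUp]

section Skew

variable {t : Form1 →ₗ[ℝ] Form1}

theorem sum_bilin_gammaUp_of_isSkewAdjoint {M : Type*} [AddCommGroup M] [Module ℝ M]
    (ht : dotForm.IsSkewAdjoint t) (f : Form1 →ₗ[ℝ] Form1 →ₗ[ℝ] M) :
    ∑ ν, f (gammaUp ν) (t (gammaLow ν)) = -∑ ν, f (t (gammaLow ν)) (gammaUp ν) := by
  have expand : ∀ ν, t (gammaLow ν) = ∑ μ, dotForm (t (gammaLow ν)) (gammaLow μ) • gammaUp μ :=
    fun ν => (sum_dotForm_smul_gammaUp _).symm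
  rw [← Finset.sum_neg_distrib,
    Finset.sum_congr rfl fun ν _ => congrArg (f (gammaUp ν)) (expand ν),
    Finset.sum_congr rfl fun ν _ => congrArg (fun u => -f u (gammaUp ν)) (expand ν)]
  simp only [map_sum, map_smul, LinearMap.sum_apply, LinearMap.smul_apply,
    ← Finset.sum_neg_distrib, ← neg_smul]
  rw [Finset.sum_comm]
  refine Finset.sum_congr rfl fun μ _ => Finset.sum_congr rfl fun ν _ => ?_
  rw [ht, dotForm_comm, Pi.neg_apply, map_neg, LinearMap.neg_apply]

theorem sum_apply_gammaLow_of_isSkewAdjoint (ht : dotForm.IsSkewAdjoint t) :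
    ∑ μ, t (gammaLow μ) μ = 0 := by
  have h := sum_bilin_gammaUp_of_isSkewAdjoint ht dotForm
  simp only [dotForm_comm _ (gammaUp _), dotForm_gammaUp] at h
  linarith

end Skew

/-! ### Products with a 1-form -/

/-- The left Clifford multiplication by a 1-form, as a bilinear map. -/
def mulL : Form1 →ₗ[ℝ] Multiform →ₗ[ℝ] Multiform :=
  LinearMap.mul ℝ Multiform ∘ₗ ofForm1

/-- The left contraction by a 1-form, as a bilinear map. -/
def contractL : Form1 →ₗ[ℝ] Multiform →ₗ[ℝ] Multiform :=
  CliffordAlgebra.contractLeft ∘ₗ dotForm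

/-- The left exterior multiplication by a 1-form, as a bilinear map. -/
def wedgeL : Form1 →ₗ[ℝ] Multiform →ₗ[ℝ] Multiform :=
  ((LinearMap.mul ℝ (ExteriorAlgebra ℝ Form1) ∘ₗ ExteriorAlgebra.ι ℝ).compl₂
    toExterior.toLinearMap).compr₂ toExterior.symm.toLinearMap

theorem mulL_apply (a : Form1) (X : Multiform) : mulL a X = ofForm1 a * X := rfl

theorem toExterior_ofForm1 (a : Form1) : toExterior (ofForm1 a) = ExteriorAlgebra.ι ℝ a :=
  CliffordAlgebra.changeForm_ι CliffordAlgebra.changeForm.associated_neg_proof _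

theorem toExterior_wedgeL (a : Form1) (X : Multiform) :
    toExterior (wedgeL a X) = ExteriorAlgebra.ι ℝ a * toExterior X := by
  simp [wedgeL]

theorem wedgeL_apply (a : Form1) (X : Multiform) : wedgeL a X = wedge (ofForm1 a) X := by
  apply toExterior.injective
  rw [toExterior_wedgeL, wedge, toExterior_ofForm1, LinearEquiv.apply_symm_apply]

theorem toExterior_contractL (a : Form1) (X : Multiform) :
    toExterior (contractL a X) =
      CliffordAlgebra.contractLeft (Q := (0 : QuadraticForm ℝ Form1)) (dotForm a)
        (toExterior X) :=
  CliffordAlgebra.changeForm_contractLeft CliffordAlgebra.changeForm.associated_neg_proof _ _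

theorem mulL_eq_wedgeL_add_contractL : mulL = wedgeL + contractL := by
  refine LinearMap.ext fun a => LinearMap.ext fun X => toExterior.injective ?_
  rw [LinearMap.add_apply, LinearMap.add_apply, map_add, toExterior_wedgeL, toExterior_contractL]
  have neg_associated : QuadraticMap.associated (R := ℝ) (-minkowskiQ) a = -dotForm a := by
    rw [map_neg]; rfl
  refine (CliffordAlgebra.changeForm_ι_mul
    CliffordAlgebra.changeForm.associated_neg_proof _ _).trans ?_
  rw [sub_eq_add_neg]
  congr 1
  rw [neg_associated, map_neg, LinearMap.neg_apply, neg_neg]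
  rfl

theorem mulL_eq_add (a : Form1) (X : Multiform) : mulL a X = wedgeL a X + contractL a X := by
  rw [mulL_eq_wedgeL_add_contractL]; rfl

theorem wedgeL_wedgeL (a b : Form1) (X : Multiform) :
    wedgeL a (wedgeL b X) = -wedgeL b (wedgeL a X) := by
  apply toExterior.injective
  rw [map_neg]
  simp only [toExterior_wedgeL, ← mul_assoc]
  rw [eq_neg_iff_add_eq_zero, ← add_mul, ExteriorAlgebra.ι_add_mul_swap, zero_mul]

theorem contractL_contractL (a b : Form1) (X : Multiform) :
    contractL a (contractL b X) = -contractL b (contractL a X) :=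
  CliffordAlgebra.contractLeft_comm _ _ _

theorem contractL_wedgeL (a b : Form1) (X : Multiform) :
    contractL a (wedgeL b X) = dotForm a b • X - wedgeL b (contractL a X) := by
  apply toExterior.injective
  rw [map_sub, map_smul]
  simp only [toExterior_wedgeL, toExterior_contractL]
  exact CliffordAlgebra.contractLeft_ι_mul _ _ _

/-! ### Bivectors acting by the commutator product -/

/-- The commutator product, as a bilinear map. -/
def commutatorL : Multiform →ₗ[ℝ] Multiform →ₗ[ℝ] Multiform :=
  (1 / 2 : ℝ) • (LinearMap.mul ℝ Multiform - (LinearMap.mul ℝ Multiform).flip)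

theorem commutatorL_apply (X Y : Multiform) : commutatorL X Y = commutator X Y := rfl

theorem commutator_mul (B X Y : Multiform) :
    commutator B (X * Y) = commutator B X * Y + X * commutator B Y := by
  simp only [commutator, smul_mul_assoc, mul_smul_comm, ← smul_add]
  congr 1
  noncomm_ring

theorem wedge_ofForm1_ofForm1 (a b : Form1) :
    wedge (ofForm1 a) (ofForm1 b) =
      ofForm1 a * ofForm1 b - algebraMap ℝ Multiform (dotForm a b) := by
  rw [← wedgeL_apply, eq_sub_iff_add_eq, ← mulL_apply, mulL_eq_add]
  congr 1
  exact (CliffordAlgebra.contractLeft_ι _ _ _).symm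

theorem ofForm1_mul_add_swap (a b : Form1) :
    ofForm1 a * ofForm1 b + ofForm1 b * ofForm1 a =
      algebraMap ℝ Multiform (2 * dotForm a b) := by
  refine (CliffordAlgebra.ι_mul_ι_add_swap a b).trans ?_
  congr 1
  simp [dotForm, QuadraticMap.associated_apply, QuadraticMap.polar]

theorem commutator_wedge_ofForm1 (a b v : Form1) :
    commutator (wedge (ofForm1 a) (ofForm1 b)) (ofForm1 v) =
      ofForm1 (dotForm b v • a - dotForm a v • b) := by
  have anticommutators : ofForm1 a * ofForm1 b * ofForm1 v - ofForm1 v * (ofForm1 a * ofForm1 b) =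
      ofForm1 a * (ofForm1 b * ofForm1 v + ofForm1 v * ofForm1 b)
        - (ofForm1 a * ofForm1 v + ofForm1 v * ofForm1 a) * ofForm1 b := by noncomm_ring
  rw [commutator, wedge_ofForm1_ofForm1, sub_mul, mul_sub,
    Algebra.commutes (dotForm a b) (ofForm1 v), sub_sub_sub_cancel_right, anticommutators,
    ofForm1_mul_add_swap, ofForm1_mul_add_swap, ← Algebra.commutes, ← Algebra.smul_def,
    ← Algebra.smul_def, map_sub, map_smul, map_smul]
  module

theorem commutator_wedge (a b : Form1) (X : Multiform) :
    commutator (wedge (ofForm1 a) (ofForm1 b)) X =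
      wedgeL a (contractL b X) - wedgeL b (contractL a X) := by
  induction X using CliffordAlgebra.left_induction with
  | algebraMap r =>
    have contractL_scalar : ∀ c, contractL c (algebraMap ℝ Multiform r) = 0 :=
      fun c => CliffordAlgebra.contractLeft_algebraMap _ _ _
    rw [contractL_scalar, contractL_scalar, commutator, Algebra.commutes]
    simp
  | add X Y hX hY =>
    simp only [← commutatorL_apply, map_add] at hX hY ⊢
    rw [hX, hY]
    abel
  | ι_mul X v hX =>
    change commutator _ (ofForm1 v * X) = wedgeL a (contractL b (mulL v X)) -
      wedgeL b (contractL a (mulL v X))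
    rw [commutator_mul, hX, commutator_wedge_ofForm1, ← mulL_apply, ← mulL_apply]
    simp only [mulL_eq_add, map_add, map_sub, map_smul, contractL_wedgeL, LinearMap.sub_apply,
      LinearMap.smul_apply]
    rw [wedgeL_wedgeL v a, wedgeL_wedgeL v b, contractL_contractL v b, contractL_contractL v a,
      map_neg, map_neg, dotForm_comm v a, dotForm_comm v b]
    module

/-- The bivector `-(1/2) γ^ν ∧ t(γ_ν)`, whose commutator product is, for skew-adjoint `t`, the
derivation of the spacetime algebra extending `t`. -/
def bivectorOf (t : Form1 →ₗ[ℝ] Form1) : Multiform :=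
  (-(1 / 2) : ℝ) • ∑ ν, wedge (ofForm1 (gammaUp ν)) (ofForm1 (t (gammaLow ν)))

section BivectorOf

variable {t : Form1 →ₗ[ℝ] Form1}

theorem sum_wedgeL_contractL_of_isSkewAdjoint (ht : dotForm.IsSkewAdjoint t) (X : Multiform) :
    ∑ ν, wedgeL (gammaUp ν) (contractL (t (gammaLow ν)) X) =
      -∑ ν, wedgeL (t (gammaLow ν)) (contractL (gammaUp ν) X) :=
  sum_bilin_gammaUp_of_isSkewAdjoint ht (wedgeL.compl₂ (contractL.flip X))

theorem commutator_bivectorOf (ht : dotForm.IsSkewAdjoint t) (X : Multiform) :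
    commutator (bivectorOf t) X = ∑ ν, wedgeL (t (gammaLow ν)) (contractL (gammaUp ν) X) := by
  simp only [← commutatorL_apply, bivectorOf, map_smul, map_sum, LinearMap.smul_apply,
    LinearMap.sum_apply]
  simp only [commutatorL_apply, commutator_wedge, Finset.sum_sub_distrib,
    sum_wedgeL_contractL_of_isSkewAdjoint ht]
  module

end BivectorOf

/-- Infinitesimal Lorentz equivariance of a product of 1-forms and multiforms: the commutator
product with the bivector of a skew-adjoint `t` is a derivation of the product. -/
def IsLorentzEquivariant (m : Form1 →ₗ[ℝ] Multiform →ₗ[ℝ] Multiform) : Prop :=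
  ∀ t : Form1 →ₗ[ℝ] Form1, dotForm.IsSkewAdjoint t → ∀ (v : Form1) (X : Multiform),
    commutator (bivectorOf t) (m v X) = m (t v) X + m v (commutator (bivectorOf t) X)

theorem isLorentzEquivariant_wedgeL : IsLorentzEquivariant wedgeL := by
  intro t ht v X
  have sum_eq := sum_dotForm_gammaUp_smul_apply_gammaLow (wedgeL.flip X ∘ₗ t) v
  simp only [LinearMap.comp_apply, LinearMap.flip_apply] at sum_eq
  simp only [commutator_bivectorOf ht, contractL_wedgeL, map_sub, map_smul, map_sum,
    wedgeL_wedgeL _ v, sub_neg_eq_add, Finset.sum_add_distrib, sum_eq]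

theorem isLorentzEquivariant_contractL : IsLorentzEquivariant contractL := by
  intro t ht v X
  have sum_eq := sum_dotForm_smul_apply_gammaUp (contractL.flip X) (t v)
  simp only [LinearMap.flip_apply, ht v, Pi.neg_apply, map_neg, neg_smul,
    Finset.sum_neg_distrib] at sum_eq
  simp only [commutator_bivectorOf ht, contractL_wedgeL, map_sum, Finset.sum_sub_distrib,
    contractL_contractL _ v, map_neg, Finset.sum_neg_distrib]
  rw [← sum_eq]
  abel

theorem IsLorentzEquivariant.add {m m' : Form1 →ₗ[ℝ] Multiform →ₗ[ℝ] Multiform}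
    (hm : IsLorentzEquivariant m) (hm' : IsLorentzEquivariant m') :
    IsLorentzEquivariant (m + m') := by
  intro t ht v X
  have hmX := hm t ht v X
  have hmX' := hm' t ht v X
  simp only [← commutatorL_apply, LinearMap.add_apply, map_add] at hmX hmX' ⊢
  rw [hmX, hmX']
  abel

theorem isLorentzEquivariant_mulL : IsLorentzEquivariant mulL :=
  mulL_eq_wedgeL_add_contractL ▸ isLorentzEquivariant_wedgeL.add isLorentzEquivariant_contractL

/-! ### Blades -/

theorem toExterior_blade (I : Finset (Fin 4)) :
    toExterior (blade I) = (Pi.basisFun ℝ (Fin 4)).ExteriorAlgebra I := by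
  simp [blade]

theorem basisFun_exteriorAlgebra_singleton (μ : Fin 4) :
    (Pi.basisFun ℝ (Fin 4)).ExteriorAlgebra {μ} = ExteriorAlgebra.ι ℝ (gammaLow μ) := by
  rw [ExteriorAlgebra.basis_apply_ofCard _ (Finset.card_singleton μ)]
  have mem_singleton : ((Set.powersetCard.ofFinEmbEquiv.symm
      (Set.powersetCard.ofCard (Finset.card_singleton μ))) 0) ∈ ({μ} : Finset (Fin 4)) :=
    Finset.orderEmbOfFin_mem _ _ _
  rw [Finset.mem_singleton] at mem_singleton
  simp [ExteriorAlgebra.ιMulti_family, mem_singleton, gammaLow]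

/-- The sign `ε` in `γ_μ ∧ γ_I = ε γ_{I ∪ {μ}}`, for `μ ∉ I`. -/
def wedgeSign (μ : Fin 4) (I : Finset (Fin 4)) : ℝ :=
  blade.repr (wedgeL (gammaLow μ) (blade I)) (insert μ I)

theorem wedgeL_blade_of_mem {μ : Fin 4} {I : Finset (Fin 4)} (hμ : μ ∈ I) :
    wedgeL (gammaLow μ) (blade I) = 0 := by
  apply toExterior.injective
  rw [toExterior_wedgeL, toExterior_blade, ← basisFun_exteriorAlgebra_singleton, map_zero]
  exact ExteriorAlgebra.basis_mul_of_not_disjoint _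
    (Set.powersetCard.ofCard (Finset.card_singleton μ)) (Set.powersetCard.ofCard (s := I) rfl)
    (by simpa using hμ)

theorem exists_wedgeL_blade_eq {μ : Fin 4} {I : Finset (Fin 4)} (hμ : μ ∉ I) :
    ∃ ε : ℝ, ε * ε = 1 ∧ wedgeL (gammaLow μ) (blade I) = ε • blade (insert μ I) := by
  have disj : Disjoint (Set.powersetCard.ofCard (Finset.card_singleton μ)).val
      (Set.powersetCard.ofCard (s := I) rfl).val := by simpa using hμ
  have basis_mul := ExteriorAlgebra.basis_mul_of_disjoint (Pi.basisFun ℝ (Fin 4)) _ _ disj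
  refine ⟨((Equiv.Perm.sign (Set.powersetCard.permOfDisjoint disj) : ℤ) : ℝ), ?_, ?_⟩
  · rw [← Int.cast_mul, ← Units.val_mul, Int.units_mul_self]
    simp
  · apply toExterior.injective
    rw [toExterior_wedgeL, map_smul, toExterior_blade, toExterior_blade,
      ← basisFun_exteriorAlgebra_singleton]
    refine basis_mul.trans ?_
    rw [Int.cast_smul_eq_zsmul, Units.smul_def]
    congr 2
    simp [Set.powersetCard.disjUnion]

theorem wedgeL_blade_of_notMem {μ : Fin 4} {I : Finset (Fin 4)} (hμ : μ ∉ I) :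
    wedgeL (gammaLow μ) (blade I) = wedgeSign μ I • blade (insert μ I) := by
  obtain ⟨ε, -, h⟩ := exists_wedgeL_blade_eq hμ
  simp [wedgeSign, h]

theorem wedgeSign_mul_self {μ : Fin 4} {I : Finset (Fin 4)} (hμ : μ ∉ I) :
    wedgeSign μ I * wedgeSign μ I = 1 := by
  obtain ⟨ε, hε, h⟩ := exists_wedgeL_blade_eq hμ
  simp [wedgeSign, h, hε]

theorem blade_insert {μ : Fin 4} {I : Finset (Fin 4)} (hμ : μ ∉ I) :
    blade (insert μ I) = wedgeSign μ I • wedgeL (gammaLow μ) (blade I) := by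
  rw [wedgeL_blade_of_notMem hμ, smul_smul, wedgeSign_mul_self hμ, one_smul]

theorem contractL_blade_of_notMem {μ : Fin 4} {I : Finset (Fin 4)} (hμ : μ ∉ I) :
    contractL (gammaLow μ) (blade I) = 0 := by
  induction I using Finset.induction_on with
  | empty =>
    apply toExterior.injective
    rw [toExterior_contractL, toExterior_blade, map_zero, ExteriorAlgebra.basis_apply_ofCard _
      Finset.card_empty, ExteriorAlgebra.ιMulti_family, ExteriorAlgebra.ιMulti_zero_apply]
    exact CliffordAlgebra.contractLeft_one _ _
  | insert ν J hν ih =>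
    rw [Finset.mem_insert, not_or] at hμ
    rw [blade_insert hν, map_smul, contractL_wedgeL, ih hμ.2, dotForm_gammaLow]
    simp [gammaLow, hμ.1]

theorem contractL_blade_of_mem {μ : Fin 4} {I : Finset (Fin 4)} (hμ : μ ∈ I) :
    contractL (gammaLow μ) (blade I) = (eta μ * wedgeSign μ (I.erase μ)) • blade (I.erase μ) := by
  have notMem_erase := Finset.notMem_erase μ I
  conv_lhs => rw [← Finset.insert_erase hμ]
  rw [blade_insert notMem_erase, map_smul, contractL_wedgeL,
    contractL_blade_of_notMem notMem_erase, dotForm_gammaLow]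
  simp [gammaLow, smul_smul, mul_comm]

/-! ### The scalar product of multiforms -/

/-- The scalar product `X · Y = ⟨X Ỹ⟩₀` of multiforms, encoded by its values on blades: they are
orthogonal with `γ_I · γ_I = ∏ i ∈ I, η_{ii}`. -/
def scalarProd : LinearMap.BilinForm ℝ Multiform :=
  ∑ I, (∏ i ∈ I, eta i) • (LinearMap.mul ℝ ℝ).compl₁₂ (blade.coord I) (blade.coord I)

theorem scalarProd_apply (X Y : Multiform) :
    scalarProd X Y = ∑ I, (∏ i ∈ I, eta i) * (blade.repr X I * blade.repr Y I) := by
  simp [scalarProd, LinearMap.sum_apply]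

theorem scalarProd_comm (X Y : Multiform) : scalarProd X Y = scalarProd Y X := by
  simp only [scalarProd_apply, mul_comm (blade.repr X _)]

theorem scalarProd_blade_left (I : Finset (Fin 4)) (Y : Multiform) :
    scalarProd (blade I) Y = (∏ i ∈ I, eta i) * blade.repr Y I := by
  simp [scalarProd_apply, Finsupp.single_apply]

theorem scalarProd_blade_blade (I J : Finset (Fin 4)) :
    scalarProd (blade I) (blade J) = if I = J then ∏ i ∈ I, eta i else 0 := by
  simp [scalarProd_blade_left, Finsupp.single_apply, eq_comm]

theorem prod_eta_mul_self (I : Finset (Fin 4)) : (∏ i ∈ I, eta i) * (∏ i ∈ I, eta i) = 1 := by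
  rw [← Finset.prod_mul_distrib]
  exact Finset.prod_eq_one fun i _ => eta_mul_self i

theorem scalarProd_bladeUp_right (X : Multiform) (I : Finset (Fin 4)) :
    scalarProd X (bladeUp I) = blade.repr X I := by
  rw [bladeUp, map_smul, scalarProd_comm, scalarProd_blade_left, smul_eq_mul, ← mul_assoc,
    prod_eta_mul_self, one_mul]

theorem repr_eq_zero_of_scalarProd_blade_eq_zero {X : Multiform} {I : Finset (Fin 4)}
    (h : scalarProd (blade I) X = 0) : blade.repr X I = 0 := by
  rw [← one_mul (blade.repr X I), ← prod_eta_mul_self I, mul_assoc, ← scalarProd_blade_left, h,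
    mul_zero]

theorem scalarProd_contractL_blade (μ : Fin 4) (I J : Finset (Fin 4)) :
    scalarProd (contractL (gammaLow μ) (blade I)) (blade J) =
      scalarProd (blade I) (wedgeL (gammaLow μ) (blade J)) := by
  by_cases hI : μ ∈ I <;> by_cases hJ : μ ∈ J
  · rw [contractL_blade_of_mem hI, wedgeL_blade_of_mem hJ, map_smul, LinearMap.smul_apply,
      scalarProd_blade_blade, if_neg, smul_zero, map_zero]
    rintro rfl
    exact Finset.notMem_erase μ I hJ
  · rw [contractL_blade_of_mem hI, wedgeL_blade_of_notMem hJ, map_smul, map_smul,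
      LinearMap.smul_apply, scalarProd_blade_blade, scalarProd_blade_blade]
    simp only [Finset.erase_eq_iff_eq_insert hI hJ]
    split_ifs with hIJ
    · rw [hIJ, Finset.erase_insert hJ, Finset.prod_insert hJ]
      simp only [smul_eq_mul]
      ring
    · rw [smul_zero, smul_zero]
  · rw [contractL_blade_of_notMem hI, wedgeL_blade_of_mem hJ, map_zero, map_zero,
      LinearMap.zero_apply]
  · rw [contractL_blade_of_notMem hI, wedgeL_blade_of_notMem hJ, map_smul, map_zero,
      scalarProd_blade_blade, if_neg, smul_zero, LinearMap.zero_apply]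
    rintro rfl
    exact hI (Finset.mem_insert_self μ J)

theorem isAdjointPair_contractL_wedgeL (a : Form1) :
    LinearMap.IsAdjointPair scalarProd scalarProd (contractL a) (wedgeL a) := by
  rw [LinearMap.isAdjointPair_iff_comp_eq_compl₂]
  refine blade.ext fun I => blade.ext fun J => ?_
  rw [LinearMap.comp_apply, LinearMap.compl₂_apply, ← sum_smul_gammaLow a]
  simp only [map_sum, map_smul, LinearMap.sum_apply, LinearMap.smul_apply,
    scalarProd_contractL_blade]

theorem isAdjointPair_wedgeL_contractL (a : Form1) :
    LinearMap.IsAdjointPair scalarProd scalarProd (wedgeL a) (contractL a) := fun X Y => by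
  rw [scalarProd_comm, ← isAdjointPair_contractL_wedgeL a, scalarProd_comm]

theorem isAdjointPair_mulL (a : Form1) :
    LinearMap.IsAdjointPair scalarProd scalarProd (mulL a) (mulL a) := by
  have h := (isAdjointPair_wedgeL_contractL a).add (isAdjointPair_contractL_wedgeL a)
  rw [add_comm (contractL a : Multiform → Multiform)] at h
  rwa [mulL_eq_wedgeL_add_contractL]

theorem isSkewAdjoint_commutator_bivectorOf {t : Form1 →ₗ[ℝ] Form1}
    (ht : dotForm.IsSkewAdjoint t) :
    scalarProd.IsSkewAdjoint (commutatorL (bivectorOf t)) := fun X Y => by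
  simp only [Pi.neg_apply, commutatorL_apply, commutator_bivectorOf ht,
    ← sum_wedgeL_contractL_of_isSkewAdjoint ht]
  simp only [map_sum, LinearMap.sum_apply, isAdjointPair_wedgeL_contractL _ _ Y,
    isAdjointPair_contractL_wedgeL _ X _]

/-! ### Grades -/

/-- The space of multiforms with grades in `S`. -/
def gradeSpace (S : Finset ℕ) : Submodule ℝ Multiform :=
  Submodule.span ℝ (blade '' {I | I.card ∈ S})

theorem mem_gradeSpace {S : Finset ℕ} {X : Multiform} :
    X ∈ gradeSpace S ↔ ∀ I : Finset (Fin 4), I.card ∉ S → blade.repr X I = 0 := by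
  rw [gradeSpace, Module.Basis.mem_span_image]
  simp only [Set.subset_def, Finset.mem_coe, Finsupp.mem_support_iff, Set.mem_ofPred_eq]
  exact forall_congr' fun I => not_imp_comm

theorem repr_gradePart (S : Finset ℕ) (X : Multiform) (I : Finset (Fin 4)) :
    blade.repr (gradePart S X) I = if I.card ∈ S then blade.repr X I else 0 := by
  rw [gradePart, map_sum, Finsupp.finsetSum_apply, Finset.sum_eq_single I]
  · split_ifs <;> simp
  · intro J _ hJ
    split_ifs <;> simp [hJ]
  · simp

theorem gradePart_eq_self_iff {S : Finset ℕ} {X : Multiform} :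
    gradePart S X = X ↔ X ∈ gradeSpace S := by
  rw [mem_gradeSpace, ← blade.repr.injective.eq_iff, Finsupp.ext_iff]
  refine forall_congr' fun I => ?_
  rw [repr_gradePart, ite_eq_left_iff, eq_comm (a := (0 : ℝ))]

theorem gradePart_eq_zero_iff {S : Finset ℕ} {X : Multiform} :
    gradePart S X = 0 ↔ ∀ I : Finset (Fin 4), I.card ∈ S → blade.repr X I = 0 := by
  rw [← blade.repr.map_eq_zero_iff, Finsupp.ext_iff]
  simp only [repr_gradePart, Finsupp.coe_zero, Pi.zero_apply, ite_eq_right_iff]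

theorem blade_mem_gradeSpace {S : Finset ℕ} {I : Finset (Fin 4)} (hI : I.card ∈ S) :
    blade I ∈ gradeSpace S :=
  Submodule.subset_span ⟨I, hI, rfl⟩

theorem gradeSpace_mono {S T : Finset ℕ} (h : S ⊆ T) : gradeSpace S ≤ gradeSpace T :=
  Submodule.span_mono (Set.image_mono fun _ hI => h hI)

theorem mapsTo_gradeSpace_of_forall_gammaLow_blade {S T : Finset ℕ}
    {m : Form1 →ₗ[ℝ] Multiform →ₗ[ℝ] Multiform}
    (hm : ∀ (μ : Fin 4) (I : Finset (Fin 4)), I.card ∈ S → m (gammaLow μ) (blade I) ∈ gradeSpace T)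
    (a : Form1) : Set.MapsTo (m a) (gradeSpace S) (gradeSpace T) := by
  suffices h : gradeSpace S ≤ (gradeSpace T).comap (m a) from fun _ hX => h hX
  refine Submodule.span_le.2 ?_
  rintro _ ⟨I, hI, rfl⟩
  rw [SetLike.mem_coe, Submodule.mem_comap, ← sum_smul_gammaLow a, map_sum, LinearMap.sum_apply]
  refine Submodule.sum_mem _ fun μ _ => ?_
  rw [map_smul, LinearMap.smul_apply]
  exact Submodule.smul_mem _ _ (hm μ I hI)

theorem card_lt_five (I : Finset (Fin 4)) : I.card < 5 :=
  Nat.lt_succ_of_le (card_finset_fin_le I)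

theorem mapsTo_wedgeL_gradeSpace (S : Finset ℕ) (a : Form1) :
    Set.MapsTo (wedgeL a) (gradeSpace S) (gradeSpace (raiseGrades S)) := by
  refine mapsTo_gradeSpace_of_forall_gammaLow_blade (fun μ I hI => ?_) a
  by_cases hμ : μ ∈ I
  · rw [wedgeL_blade_of_mem hμ]
    exact Submodule.zero_mem _
  · rw [wedgeL_blade_of_notMem hμ]
    refine Submodule.smul_mem _ _ (blade_mem_gradeSpace ?_)
    rw [raiseGrades, Finset.mem_filter, Finset.mem_range]
    exact ⟨card_lt_five _, _, hI, Finset.card_insert_of_notMem hμ⟩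

theorem mapsTo_contractL_gradeSpace (S : Finset ℕ) (a : Form1) :
    Set.MapsTo (contractL a) (gradeSpace S) (gradeSpace (lowerGrades S)) := by
  refine mapsTo_gradeSpace_of_forall_gammaLow_blade (fun μ I hI => ?_) a
  by_cases hμ : μ ∈ I
  · rw [contractL_blade_of_mem hμ]
    refine Submodule.smul_mem _ _ (blade_mem_gradeSpace ?_)
    rw [lowerGrades, Finset.mem_filter, Finset.mem_range, Finset.card_erase_add_one hμ]
    exact ⟨card_lt_five _, hI⟩
  · rw [contractL_blade_of_notMem hμ]
    exact Submodule.zero_mem _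

theorem mapsTo_mulL_gradeSpace (S : Finset ℕ) (a : Form1) :
    Set.MapsTo (mulL a) (gradeSpace S) (gradeSpace (lowerGrades S ∪ raiseGrades S)) := by
  intro X hX
  rw [mulL_eq_add]
  exact Submodule.add_mem _
    (gradeSpace_mono Finset.subset_union_right (mapsTo_wedgeL_gradeSpace S a hX))
    (gradeSpace_mono Finset.subset_union_left (mapsTo_contractL_gradeSpace S a hX))

theorem raiseGrades_lowerGrades_subset (S : Finset ℕ) : raiseGrades (lowerGrades S) ⊆ S := by
  intro p hp
  obtain ⟨-, q, hq, rfl⟩ := Finset.mem_filter.1 hp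
  exact (Finset.mem_filter.1 hq).2

theorem lowerGrades_raiseGrades_subset (S : Finset ℕ) : lowerGrades (raiseGrades S) ⊆ S := by
  intro p hp
  simp only [raiseGrades, lowerGrades, Finset.mem_filter] at hp
  obtain ⟨-, -, q, hq, h⟩ := hp
  rwa [Nat.add_right_cancel h]

theorem lowerGrades_union_raiseGrades_subset {S : Finset ℕ}
    (hS : ∀ p ∈ S, ∀ q ∈ Finset.range 5, Even (p + q) → q ∈ S) :
    lowerGrades (lowerGrades S ∪ raiseGrades S) ∪ raiseGrades (lowerGrades S ∪ raiseGrades S)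
      ⊆ S := by
  intro p hp
  simp only [Finset.mem_union, lowerGrades, raiseGrades, Finset.mem_filter,
    Finset.mem_range] at hp
  grind

theorem mapsTo_commutator_bivectorOf_gradeSpace {t : Form1 →ₗ[ℝ] Form1}
    (ht : dotForm.IsSkewAdjoint t) (S : Finset ℕ) :
    Set.MapsTo (commutator (bivectorOf t)) (gradeSpace S) (gradeSpace S) := by
  intro X hX
  rw [commutator_bivectorOf ht]
  exact Submodule.sum_mem _ fun ν _ => gradeSpace_mono (raiseGrades_lowerGrades_subset S)
    (mapsTo_wedgeL_gradeSpace _ _ (mapsTo_contractL_gradeSpace S _ hX))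

/-! ### Multiform derivatives -/

theorem multiformDeriv_mem_gradeSpace (S : Finset ℕ) (f : Multiform → ℝ) (X : Multiform) :
    multiformDeriv S f X ∈ gradeSpace S := by
  refine Submodule.sum_mem _ fun I _ => ?_
  split_ifs with hI
  · exact Submodule.smul_mem _ _ (Submodule.smul_mem _ _ (blade_mem_gradeSpace hI))
  · exact Submodule.zero_mem _

theorem scalarProd_multiformDeriv {S : Finset ℕ} (f : Multiform → ℝ) (X : Multiform)
    {B : Multiform} (hB : B ∈ gradeSpace S) :
    scalarProd B (multiformDeriv S f X) = fderiv ℝ f X B := by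
  conv_rhs => rw [← blade.sum_repr B]
  rw [multiformDeriv, map_sum, map_sum]
  refine Finset.sum_congr rfl fun I _ => ?_
  rw [map_smul]
  split_ifs with hI
  · rw [map_smul, scalarProd_bladeUp_right, smul_eq_mul, smul_eq_mul, mul_comm]
  · rw [mem_gradeSpace.1 hB I hI, map_zero, zero_smul]

/-! ### The connection of the gauge metric -/

theorem dotForm_adj (t : Form1 →L[ℝ] Form1) (a b : Form1) :
    dotForm (adj t a) b = dotForm a (t b) := by
  conv_rhs => rw [← sum_smul_gammaLow b]
  simp only [adj, map_sum, map_smul, LinearMap.sum_apply, LinearMap.smul_apply, dotForm_gammaUp,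
    smul_eq_mul, mul_comm]

theorem trace_eq_sum_apply_gammaLow (t : Form1 →ₗ[ℝ] Form1) :
    LinearMap.trace ℝ Form1 t = ∑ μ, t (gammaLow μ) μ := by
  rw [LinearMap.trace_eq_matrix_trace ℝ (Pi.basisFun ℝ (Fin 4))]
  simp [Matrix.trace, gammaLow]

section Connection

variable {h : Form1 → Form1 →L[ℝ] Form1} {x : Form1}

theorem dotForm_hStar (a b : Form1) : dotForm (hStar h x a) b = dotForm a ((h x).inverse b) :=
  dotForm_adj _ _ _

theorem dotForm_hStar_apply (hi : (h x).IsInvertible) (a b : Form1) :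
    dotForm (hStar h x a) (h x b) = dotForm a b := by
  rw [dotForm_hStar, hi.inverse_apply_self]

theorem dotForm_apply_sum_inverse_hStar (hi : (h x).IsInvertible) (f : Form1 →ₗ[ℝ] ℝ)
    (c : Form1) :
    dotForm (h x (∑ μ, f (gammaLow μ) • (h x).inverse (hStar h x (gammaUp μ)))) (h x c) = f c := by
  simp only [map_sum, map_smul, LinearMap.sum_apply, LinearMap.smul_apply, hi.self_apply_inverse,
    dotForm_hStar_apply hi, smul_eq_mul, mul_comm (f _)]
  exact sum_dotForm_gammaUp_smul_apply_gammaLow f c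

theorem gaugeMetric_comm (a b : Form1) : gaugeMetric h x a b = gaugeMetric h x b a :=
  dotForm_comm _ _

theorem christoffel_comm (a b : Form1) : christoffel h x a b = christoffel h x b a := by
  simp only [christoffel, gaugeMetric_comm a b]
  congr 1
  exact Finset.sum_congr rfl fun μ _ => by rw [add_comm (fderiv _ _ _ a)]

theorem fderiv_gaugeMetric (hd : DifferentiableAt ℝ h x) (a b c : Form1) :
    fderiv ℝ (fun y => gaugeMetric h y b c) x a =
      dotForm (fderiv ℝ h x a b) (h x c) + dotForm (h x b) (fderiv ℝ h x a c) := by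
  have fderiv_h_apply : ∀ d, fderiv ℝ (fun y => h y d) x a = fderiv ℝ h x a d := fun d => by
    rw [fderiv_clm_apply hd (differentiableAt_const d)]
    simp
  simp only [gaugeMetric]
  rw [fderiv_bilinear_apply dotForm (hd.clm_apply (differentiableAt_const b))
    (hd.clm_apply (differentiableAt_const c)), fderiv_h_apply, fderiv_h_apply]

/-- The linear form `c ↦ (a·∂ g(b, c) + b·∂ g(a, c) - c·∂ g(a, b)) / 2` of the Koszul formula for
the metric `g(a, b) = h(a) · h(b)`. -/
def koszulForm (h : Form1 → Form1 →L[ℝ] Form1) (x a b : Form1) : Form1 →ₗ[ℝ] ℝ :=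
  (1 / 2 : ℝ) • (dotForm (fderiv ℝ h x a b) ∘ₗ (h x : Form1 →ₗ[ℝ] Form1)
    + dotForm (h x b) ∘ₗ (fderiv ℝ h x a : Form1 →ₗ[ℝ] Form1)
    + dotForm (fderiv ℝ h x b a) ∘ₗ (h x : Form1 →ₗ[ℝ] Form1)
    + dotForm (h x a) ∘ₗ (fderiv ℝ h x b : Form1 →ₗ[ℝ] Form1)
    - dotForm (h x b) ∘ₗ ((fderiv ℝ h x).flip a : Form1 →ₗ[ℝ] Form1)
    - dotForm (h x a) ∘ₗ ((fderiv ℝ h x).flip b : Form1 →ₗ[ℝ] Form1))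

theorem koszulForm_apply (a b c : Form1) :
    koszulForm h x a b c = (1 / 2 : ℝ) *
      (dotForm (fderiv ℝ h x a b) (h x c) + dotForm (h x b) (fderiv ℝ h x a c)
        + dotForm (fderiv ℝ h x b a) (h x c) + dotForm (h x a) (fderiv ℝ h x b c)
        - dotForm (h x b) (fderiv ℝ h x c a) - dotForm (h x a) (fderiv ℝ h x c b)) := rfl

theorem koszulForm_apply_add_swap (a b c : Form1) :
    koszulForm h x a b c + koszulForm h x a c b =
      dotForm (fderiv ℝ h x a b) (h x c) + dotForm (h x b) (fderiv ℝ h x a c) := by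
  simp only [koszulForm_apply, dotForm_comm (fderiv ℝ h x _ _)]
  ring

theorem christoffel_eq_sum_koszulForm (hd : DifferentiableAt ℝ h x) (a b : Form1) :
    christoffel h x a b =
      ∑ μ, koszulForm h x a b (gammaLow μ) • (h x).inverse (hStar h x (gammaUp μ)) := by
  simp only [christoffel, fderiv_gaugeMetric hd, koszulForm_apply, Finset.smul_sum, smul_smul]
  refine Finset.sum_congr rfl fun μ _ => ?_
  congr 2
  rw [dotForm_comm (fderiv ℝ h x (gammaLow μ) a)]
  ring

theorem dotForm_apply_christoffel (hd : DifferentiableAt ℝ h x) (hi : (h x).IsInvertible)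
    (a b c : Form1) : dotForm (h x (christoffel h x a b)) (h x c) = koszulForm h x a b c := by
  rw [christoffel_eq_sum_koszulForm hd, dotForm_apply_sum_inverse_hStar hi]

theorem gaugeDerivForm1_const (hd : DifferentiableAt ℝ h x) (hi : (h x).IsInvertible)
    (a v : Form1) :
    gaugeDerivForm1 h a (fun _ => v) x =
      h x (christoffel h x a ((h x).inverse v)) - fderiv ℝ h x a ((h x).inverse v) := by
  rw [gaugeDerivForm1, leviCivita, map_add, apply_fderiv_inverse_apply hd hi]
  abel

theorem dotForm_gaugeDerivForm1_const (hd : DifferentiableAt ℝ h x) (hi : (h x).IsInvertible)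
    (a v w : Form1) :
    dotForm (gaugeDerivForm1 h a (fun _ => v) x) w =
      -dotForm v (gaugeDerivForm1 h a (fun _ => w) x) := by
  obtain ⟨b, rfl⟩ := hi.surjective v
  obtain ⟨c, rfl⟩ := hi.surjective w
  rw [gaugeDerivForm1_const hd hi, gaugeDerivForm1_const hd hi, hi.inverse_apply_self,
    hi.inverse_apply_self, map_sub, map_sub, LinearMap.sub_apply,
    dotForm_apply_christoffel hd hi, dotForm_comm (h x b) (h x _), dotForm_apply_christoffel hd hi]
  linarith [koszulForm_apply_add_swap (h := h) (x := x) a b c]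

/-- The connection of `𝒟` on 1-forms: the endomorphism `v ↦ 𝒟_a v` for constant `v`, defined as
the linear extension of `γ_ν ↦ 𝒟_a γ_ν`. -/
def connection (h : Form1 → Form1 →L[ℝ] Form1) (x a : Form1) : Form1 →ₗ[ℝ] Form1 :=
  (Pi.basisFun ℝ (Fin 4)).constr ℝ fun ν => gaugeDerivForm1 h a (fun _ => gammaLow ν) x

theorem connection_gammaLow (a : Form1) (ν : Fin 4) :
    connection h x a (gammaLow ν) = gaugeDerivForm1 h a (fun _ => gammaLow ν) x := by
  have gammaLow_eq : gammaLow ν = Pi.basisFun ℝ (Fin 4) ν := (Pi.basisFun_apply ..).symm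
  exact (congrArg (connection h x a) gammaLow_eq).trans (Module.Basis.constr_basis _ _ _ _)

theorem Omega_eq_bivectorOf_connection (a : Form1) :
    Omega h x a = bivectorOf (connection h x a) := by
  simp only [Omega, bivectorOf, connection_gammaLow]

theorem connection_apply (hd : DifferentiableAt ℝ h x) (hi : (h x).IsInvertible) (a v : Form1) :
    connection h x a v = gaugeDerivForm1 h a (fun _ => v) x := by
  refine eq_of_forall_dotForm_eq fun w => ?_
  rw [dotForm_gaugeDerivForm1_const hd hi, ← sum_smul_gammaLow v]
  simp only [map_sum, map_smul, LinearMap.sum_apply, LinearMap.smul_apply, connection_gammaLow,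
    dotForm_gaugeDerivForm1_const hd hi, smul_neg, Finset.sum_neg_distrib]

theorem isSkewAdjoint_connection (hd : DifferentiableAt ℝ h x) (hi : (h x).IsInvertible)
    (a : Form1) : dotForm.IsSkewAdjoint (connection h x a) := by
  intro v w
  rw [Pi.neg_apply, map_neg, connection_apply hd hi, connection_apply hd hi,
    dotForm_gaugeDerivForm1_const hd hi]

/-- The connection is torsion-free: this is Cartan's first structure equation for the frame `h`. -/
theorem fderiv_apply_add_connection_comm (hd : DifferentiableAt ℝ h x) (hi : (h x).IsInvertible)
    (a b : Form1) :
    fderiv ℝ h x a b + connection h x a (h x b) =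
      fderiv ℝ h x b a + connection h x b (h x a) := by
  simp only [connection_apply hd hi, gaugeDerivForm1_const hd hi, hi.inverse_apply_self,
    christoffel_comm a b, add_sub_cancel]

/-! ### Regularity of the connection -/

theorem contDiffAt_koszulForm_apply {n : WithTop ℕ∞} (hd : ContDiffAt ℝ (n + 1) h x)
    {a b c : Form1 → Form1} (ha : ContDiffAt ℝ n a x) (hb : ContDiffAt ℝ n b x)
    (hc : ContDiffAt ℝ n c x) :
    ContDiffAt ℝ n (fun y => koszulForm h y (a y) (b y) (c y)) x := by
  have hd_n : ContDiffAt ℝ n h x := hd.of_le le_self_add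
  have product : ∀ {p q r : Form1 → Form1}, ContDiffAt ℝ n p x → ContDiffAt ℝ n q x →
      ContDiffAt ℝ n r x →
      ContDiffAt ℝ n (fun y => dotForm (h y (p y)) (fderiv ℝ h y (q y) (r y))) x :=
    fun hp hq hr => contDiffAt_bilinear dotForm (hd_n.clm_apply hp)
      (((hd.fderiv_right le_rfl).clm_apply hq).clm_apply hr)
  simp only [koszulForm_apply, dotForm_comm (fderiv ℝ h _ _ _)]
  exact contDiffAt_const.mul ((((((product hc ha hb).add (product hb ha hc)).add
    (product hc hb ha)).add (product ha hb hc)).sub (product hb hc ha)).sub (product ha hc hb))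

theorem contDiffAt_hStar {n : WithTop ℕ∞} (hd : ContDiffAt ℝ n h x) (hi : (h x).IsInvertible)
    (a : Form1) : ContDiffAt ℝ n (fun y => hStar h y a) x := by
  simp only [hStar, adj]
  exact ContDiffAt.sum fun μ _ => (contDiffAt_linear (dotForm a)
    ((contDiffAt_inverse hd hi).clm_apply contDiffAt_const)).smul contDiffAt_const

theorem contDiffAt_gaugeDerivForm1_const {n : WithTop ℕ∞} (hd : ContDiffAt ℝ (n + 1) h x)
    (hi : (h x).IsInvertible) (a v : Form1) :
    ContDiffAt ℝ n (gaugeDerivForm1 h a (fun _ => v)) x := by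
  have koszul : gaugeDerivForm1 h a (fun _ => v) =ᶠ[nhds x] fun y =>
      h y (∑ μ, koszulForm h y a ((h y).inverse v) (gammaLow μ)
          • (h y).inverse (hStar h y (gammaUp μ)))
        - fderiv ℝ h y a ((h y).inverse v) := by
    have contDiff_near : ∀ᶠ y in nhds x, ContDiffAt ℝ 1 h y :=
      (hd.of_le le_add_self).eventually (by simp)
    filter_upwards [contDiff_near, eventually_isInvertible hd.continuousAt hi] with y hy hiy
    have hy' := hy.differentiableAt one_ne_zero
    rw [gaugeDerivForm1_const hy' hiy, christoffel_eq_sum_koszulForm hy']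
  refine ContDiffAt.congr_of_eventuallyEq ?_ koszul
  have hd_n : ContDiffAt ℝ n h x := hd.of_le le_self_add
  have hinv := contDiffAt_inverse hd_n hi
  have hinv_v : ContDiffAt ℝ n (fun y => (h y).inverse v) x := hinv.clm_apply contDiffAt_const
  exact (hd_n.clm_apply (ContDiffAt.sum fun μ _ =>
    (contDiffAt_koszulForm_apply hd contDiffAt_const hinv_v contDiffAt_const).smul
      (hinv.clm_apply (contDiffAt_hStar hd_n hi _)))).sub
    (((hd.fderiv_right le_rfl).clm_apply contDiffAt_const).clm_apply hinv_v)

theorem contDiffAt_Omega {n : WithTop ℕ∞} (hd : ContDiffAt ℝ (n + 1) h x)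
    (hi : (h x).IsInvertible) (a : Form1) : ContDiffAt ℝ n (fun y => Omega h y a) x := by
  simp only [Omega, ← wedgeL_apply]
  exact ContDiffAt.const_smul _ (ContDiffAt.sum fun ν _ =>
    contDiffAt_linear (wedgeL (gammaUp ν) ∘ₗ ofForm1)
      (contDiffAt_gaugeDerivForm1_const hd hi a (gammaLow ν)))

/-! ### The divergence of the weighted reciprocal frame -/

theorem fderiv_det_comp_apply (hd : DifferentiableAt ℝ h x) (hi : (h x).IsInvertible)
    (a : Form1) :
    fderiv ℝ (fun y => (h y).det) x a =
      (h x).det * ∑ μ, (h x).inverse (fderiv ℝ h x a (gammaLow μ)) μ := by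
  have chain_rule := ((contDiff_det (n := 1)).differentiable one_ne_zero (h x)).hasFDerivAt.comp x
    hd.hasFDerivAt
  rw [show fderiv ℝ (fun y => (h y).det) x a = _ from DFunLike.congr_fun chain_rule.fderiv a]
  exact (fderiv_det_apply hi _).trans (by rw [trace_eq_sum_apply_gammaLow]; rfl)

theorem dotForm_fderiv_hStar (hd : ContDiffAt ℝ 1 h x) (hi : (h x).IsInvertible) (a b c : Form1) :
    dotForm (fderiv ℝ (fun y => hStar h y b) x a) (h x c) =
      -dotForm b ((h x).inverse (fderiv ℝ h x a c)) := by
  have hd' := hd.differentiableAt one_ne_zero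
  have pairing_const : (fun y => dotForm (hStar h y b) (h y c)) =ᶠ[nhds x] fun _ => dotForm b c :=
    (eventually_isInvertible hd.continuousAt hi).mono fun y hy => dotForm_hStar_apply hy b c
  have product_rule := fderiv_bilinear_apply dotForm
    ((contDiffAt_hStar hd hi b).differentiableAt one_ne_zero)
    (hd'.clm_apply (differentiableAt_const c)) a
  rw [pairing_const.fderiv_eq, fderiv_fun_const, fderiv_clm_apply hd' (differentiableAt_const c)]
    at product_rule
  rw [← dotForm_hStar]
  simpa using eq_neg_of_add_eq_zero_left product_rule.symm

theorem sum_inverse_connection_apply (hd : DifferentiableAt ℝ h x) (hi : (h x).IsInvertible)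
    (c : Form1) : ∑ μ, (h x).inverse (connection h x c (h x (gammaLow μ))) μ = 0 := by
  let hx : Form1 →ₗ[ℝ] Form1 := (h x : Form1 →ₗ[ℝ] Form1)
  let hx_inv : Form1 →ₗ[ℝ] Form1 := ((h x).inverse : Form1 →ₗ[ℝ] Form1)
  have cancel : (connection h x c ∘ₗ hx) ∘ₗ hx_inv = connection h x c := by
    ext1 ν
    exact LinearMap.ext_ring (congrArg (connection h x c) (hi.self_apply_inverse _))
  calc ∑ μ, (h x).inverse (connection h x c (h x (gammaLow μ))) μ
      = LinearMap.trace ℝ Form1 (hx_inv ∘ₗ connection h x c ∘ₗ hx) :=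
        (trace_eq_sum_apply_gammaLow (hx_inv ∘ₗ connection h x c ∘ₗ hx)).symm
    _ = LinearMap.trace ℝ Form1 (connection h x c) := by rw [LinearMap.trace_comp_comm', cancel]
    _ = 0 := by
        rw [trace_eq_sum_apply_gammaLow,
          sum_apply_gammaLow_of_isSkewAdjoint (isSkewAdjoint_connection hd hi c)]

theorem dotForm_fderiv_det_smul_hStar (hd : ContDiffAt ℝ 1 h x) (hi : (h x).IsInvertible)
    (a b c : Form1) :
    dotForm (fderiv ℝ (fun y => (h y).det • hStar h y b) x a) (h x c) =
      fderiv ℝ (fun y => (h y).det) x a * dotForm b c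
        - (h x).det * dotForm b ((h x).inverse (fderiv ℝ h x a c)) := by
  rw [fderiv_fun_smul ((contDiffAt_det hd).differentiableAt one_ne_zero)
    ((contDiffAt_hStar hd hi _).differentiableAt one_ne_zero)]
  simp only [_root_.add_apply, _root_.smul_apply, ContinuousLinearMap.smulRight_apply, map_add,
    map_smul, LinearMap.add_apply, LinearMap.smul_apply, smul_eq_mul, dotForm_fderiv_hStar hd hi,
    dotForm_hStar_apply hi]
  ring

/-- The derivative of `det h` is a trace, which the torsion-free connection, being skew, turns into
the remaining terms. -/
theorem sum_fderiv_det_smul_hStar (hd : ContDiffAt ℝ 1 h x) (hi : (h x).IsInvertible) :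
    ∑ μ, (fderiv ℝ (fun y => (h y).det • hStar h y (gammaUp μ)) x (gammaLow μ)
      + (h x).det • connection h x (gammaLow μ) (hStar h x (gammaUp μ))) = 0 := by
  have hd' := hd.differentiableAt one_ne_zero
  refine eq_of_forall_dotForm_eq fun v => ?_
  obtain ⟨c, rfl⟩ := hi.surjective v
  have pairing_connection : ∀ μ,
      dotForm (connection h x (gammaLow μ) (hStar h x (gammaUp μ))) (h x c) =
        -(h x).inverse (connection h x (gammaLow μ) (h x c)) μ := by
    intro μ
    rw [isSkewAdjoint_connection hd' hi, Pi.neg_apply, map_neg, dotForm_hStar, dotForm_gammaUp]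
  have det_term : ∑ μ, c μ * fderiv ℝ (fun y => (h y).det) x (gammaLow μ) =
      (h x).det * ∑ μ, (h x).inverse (fderiv ℝ h x c (gammaLow μ)) μ := by
    rw [← fderiv_det_comp_apply hd' hi]
    conv_rhs => rw [← sum_smul_gammaLow c]
    simp only [map_sum, map_smul, smul_eq_mul]
  have torsion_free : ∀ μ, (h x).inverse (fderiv ℝ h x c (gammaLow μ)) μ
      + (h x).inverse (connection h x c (h x (gammaLow μ))) μ =
        (h x).inverse (fderiv ℝ h x (gammaLow μ) c) μ
          + (h x).inverse (connection h x (gammaLow μ) (h x c)) μ := fun μ => by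
    simpa using congrArg (fun u => (h x).inverse u μ)
      (fderiv_apply_add_connection_comm hd' hi c (gammaLow μ))
  have torsion_free_sum := Finset.sum_congr rfl fun μ (_ : μ ∈ Finset.univ) => torsion_free μ
  rw [Finset.sum_add_distrib, Finset.sum_add_distrib, sum_inverse_connection_apply hd' hi]
    at torsion_free_sum
  rw [map_sum, LinearMap.sum_apply]
  simp only [map_add, map_smul, LinearMap.add_apply, LinearMap.smul_apply,
    dotForm_fderiv_det_smul_hStar hd hi, dotForm_gammaUp, mul_comm (fderiv ℝ _ x _),
    pairing_connection, smul_eq_mul, Finset.sum_add_distrib, Finset.sum_sub_distrib, det_term,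
    ← Finset.mul_sum, Finset.sum_neg_distrib, map_zero, LinearMap.zero_apply]
  linear_combination (h x).det * torsion_free_sum

end Connection

/-! ### Covariant differential operators -/

/-- The operator `∑ μ, h^⋆(γ^μ) ∗ 𝒟_{γ_μ} X` for a bilinear product `∗` of 1-forms and
multiforms; its instances are the `h`-divergence, the `h`-curl and the `h`-gradient. -/
def covDeriv (m : Form1 →ₗ[ℝ] Multiform →ₗ[ℝ] Multiform) (h : Form1 → Form1 →L[ℝ] Form1)
    (X : Form1 → Multiform) (x : Form1) : Multiform :=
  ∑ μ, m (hStar h x (gammaUp μ)) (gaugeDeriv h (gammaLow μ) X x)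

theorem covDeriv_contractL (h : Form1 → Form1 →L[ℝ] Form1) : covDeriv contractL h = hDiv h := rfl

theorem covDeriv_wedgeL (h : Form1 → Form1 →L[ℝ] Form1) : covDeriv wedgeL h = hCurl h := by
  funext X x
  simp only [hCurl, covDeriv, wedgeL_apply]

theorem covDeriv_mulL (h : Form1 → Form1 →L[ℝ] Form1) : covDeriv mulL h = hGrad h := rfl

section CovDeriv

variable {h : Form1 → Form1 →L[ℝ] Form1} {m m' : Form1 →ₗ[ℝ] Multiform →ₗ[ℝ] Multiform}
  {S T : Finset ℕ} {A X Y : Form1 → Multiform} {x : Form1}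

theorem contDiffAt_gaugeDeriv {n : WithTop ℕ∞} (hd : ContDiffAt ℝ (n + 1) h x)
    (hi : (h x).IsInvertible) (hX : ContDiffAt ℝ (n + 1) X x) (a : Form1) :
    ContDiffAt ℝ n (gaugeDeriv h a X) x :=
  ((hX.fderiv_right le_rfl).clm_apply contDiffAt_const).add
    (contDiffAt_bilinear commutatorL (contDiffAt_Omega hd hi a) (hX.of_le le_self_add))

theorem contDiffAt_covDeriv {n k : WithTop ℕ∞} (m : Form1 →ₗ[ℝ] Multiform →ₗ[ℝ] Multiform)
    (hd : ContDiffAt ℝ k h x) (hi : (h x).IsInvertible) (hX : ContDiffAt ℝ k X x)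
    (hnk : n + 1 ≤ k) : ContDiffAt ℝ n (covDeriv m h X) x :=
  ContDiffAt.sum fun μ _ => contDiffAt_bilinear m
    (contDiffAt_hStar (hd.of_le (le_self_add.trans hnk)) hi (gammaUp μ))
    (contDiffAt_gaugeDeriv (hd.of_le hnk) hi (hX.of_le hnk) (gammaLow μ))

theorem covDeriv_add_smul (hX : DifferentiableAt ℝ X x) (hA : DifferentiableAt ℝ A x) (t : ℝ) :
    covDeriv m h (X + t • A) x = covDeriv m h X x + t • covDeriv m h A x := by
  simp only [covDeriv, gaugeDeriv, ← commutatorL_apply, fderiv_add hX (hA.const_smul t),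
    fderiv_const_smul hA, _root_.add_apply, _root_.smul_apply, Pi.add_apply, Pi.smul_apply,
    map_add, map_smul, Finset.smul_sum, ← Finset.sum_add_distrib]
  exact Finset.sum_congr rfl fun μ _ => by module

theorem covDeriv_eq_zero_of_notMem_tsupport (hx : x ∉ tsupport A) : covDeriv m h A x = 0 := by
  have fderiv_zero : fderiv ℝ A x = 0 :=
    Function.notMem_support.1 fun hx' => hx (support_fderiv_subset ℝ hx')
  simp [covDeriv, gaugeDeriv, ← commutatorL_apply, fderiv_zero, image_eq_zero_of_notMem_tsupport hx]

theorem gaugeDeriv_mem_gradeSpace (hd : DifferentiableAt ℝ h x) (hi : (h x).IsInvertible)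
    (hX : DifferentiableAt ℝ X x) (hXS : ∀ y, X y ∈ gradeSpace S) (a : Form1) :
    gaugeDeriv h a X x ∈ gradeSpace S := by
  rw [gaugeDeriv, Omega_eq_bivectorOf_connection]
  exact Submodule.add_mem _ (fderiv_apply_mem_of_eventually_mem hX (.of_forall hXS) a)
    (mapsTo_commutator_bivectorOf_gradeSpace (isSkewAdjoint_connection hd hi a) S (hXS x))

theorem covDeriv_mem_gradeSpace (hm : ∀ a, Set.MapsTo (m a) (gradeSpace S) (gradeSpace T))
    (hd : DifferentiableAt ℝ h x) (hi : (h x).IsInvertible) (hX : DifferentiableAt ℝ X x)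
    (hXS : ∀ y, X y ∈ gradeSpace S) : covDeriv m h X x ∈ gradeSpace T :=
  Submodule.sum_mem _ fun μ _ => hm _ (gaugeDeriv_mem_gradeSpace hd hi hX hXS (gammaLow μ))

/-! ### Green's identity -/

/-- The metricity of `𝒟`: since `Ω(a) ×` is skew for the scalar product, it drops out of the
derivative of the scalar `A · (w ∗ Y)`. -/
theorem fderiv_scalarProd_apply (hm : IsLorentzEquivariant m) (hd : DifferentiableAt ℝ h x)
    (hi : (h x).IsInvertible) {w : Form1 → Form1} (hA : DifferentiableAt ℝ A x)
    (hw : DifferentiableAt ℝ w x) (hY : DifferentiableAt ℝ Y x) (a : Form1) :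
    fderiv ℝ (fun y => scalarProd (A y) (m (w y) (Y y))) x a =
      scalarProd (gaugeDeriv h a A x) (m (w x) (Y x))
        + scalarProd (A x) (m (w x) (gaugeDeriv h a Y x))
        + scalarProd (A x) (m (fderiv ℝ w x a + connection h x a (w x)) (Y x)) := by
  have hK := isSkewAdjoint_connection hd hi a
  have skew : scalarProd (commutator (bivectorOf (connection h x a)) (A x)) (m (w x) (Y x)) =
      -scalarProd (A x) (commutator (bivectorOf (connection h x a)) (m (w x) (Y x))) := by
    simpa [commutatorL_apply] using isSkewAdjoint_commutator_bivectorOf hK (A x) (m (w x) (Y x))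
  rw [fderiv_bilinear_apply scalarProd hA (differentiableAt_bilinear m hw hY),
     fderiv_bilinear_apply m hw hY]
  simp only [gaugeDeriv, Omega_eq_bivectorOf_connection, map_add, LinearMap.add_apply, skew,
    hm _ hK]
  ring

/-- The `μ`-th component of the current `det(h) (A · (h^⋆(γ^μ) ∗ Y))`, whose divergence is the
boundary term in Green's identity. -/
def current (m : Form1 →ₗ[ℝ] Multiform →ₗ[ℝ] Multiform) (h : Form1 → Form1 →L[ℝ] Form1)
    (A Y : Form1 → Multiform) (μ : Fin 4) (x : Form1) : ℝ :=
  scalarProd (A x) (m ((h x).det • hStar h x (gammaUp μ)) (Y x))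

theorem contDiffAt_current {n : WithTop ℕ∞} (m : Form1 →ₗ[ℝ] Multiform →ₗ[ℝ] Multiform)
    (hd : ContDiffAt ℝ n h x) (hi : (h x).IsInvertible) (hA : ContDiffAt ℝ n A x)
    (hY : ContDiffAt ℝ n Y x) (μ : Fin 4) : ContDiffAt ℝ n (current m h A Y μ) x :=
  contDiffAt_bilinear scalarProd hA
    (contDiffAt_bilinear m ((contDiffAt_det hd).smul (contDiffAt_hStar hd hi _)) hY)

theorem sum_fderiv_current (hm' : IsLorentzEquivariant m')
    (hadj : ∀ a, LinearMap.IsAdjointPair scalarProd scalarProd (m a) (m' a))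
    (hd : ContDiffAt ℝ 1 h x) (hi : (h x).IsInvertible) (hA : DifferentiableAt ℝ A x)
    (hY : DifferentiableAt ℝ Y x) :
    ∑ μ, fderiv ℝ (current m' h A Y μ) x (gammaLow μ) =
      (h x).det * (scalarProd (covDeriv m h A x) (Y x)
        + scalarProd (A x) (covDeriv m' h Y x)) := by
  have frame_differentiable : ∀ μ,
      DifferentiableAt ℝ (fun y => (h y).det • hStar h y (gammaUp μ)) x := fun μ =>
    ((contDiffAt_det hd).smul (contDiffAt_hStar hd hi _)).differentiableAt one_ne_zero
  have adjoint : ∀ a Z W, scalarProd (m a Z) W = scalarProd Z (m' a W) := fun a => hadj a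
  have frame_divergence := congrArg (fun v => scalarProd (A x) (m' v (Y x)))
    (sum_fderiv_det_smul_hStar hd hi)
  simp only [map_sum, map_zero, LinearMap.sum_apply, LinearMap.zero_apply] at frame_divergence
  change ∑ μ, fderiv ℝ (fun y => scalarProd (A y) (m' ((h y).det • hStar h y (gammaUp μ)) (Y y)))
    x (gammaLow μ) = _
  simp only [fderiv_scalarProd_apply hm' (hd.differentiableAt one_ne_zero) hi hA
    (frame_differentiable _) hY, Finset.sum_add_distrib, map_smul (connection h x _),
    frame_divergence, add_zero]
  simp only [covDeriv, map_sum, map_smul, LinearMap.sum_apply, LinearMap.smul_apply, smul_eq_mul,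
    adjoint, mul_add, Finset.mul_sum]

theorem setIntegral_covDeriv_add_eq_zero (hm' : IsLorentzEquivariant m')
    (hadj : ∀ a, LinearMap.IsAdjointPair scalarProd scalarProd (m a) (m' a))
    (hA : ContDiff ℝ 1 A) (hc : HasCompactSupport A)
    (hd : ∀ x ∈ tsupport A, ContDiffAt ℝ 1 h x) (hi : ∀ x ∈ tsupport A, (h x).IsInvertible)
    (hY : ∀ x ∈ tsupport A, ContDiffAt ℝ 1 Y x) :
    ∫ x in tsupport A, (h x).det * (scalarProd (covDeriv m h A x) (Y x)
      + scalarProd (A x) (covDeriv m' h Y x)) = 0 := by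
  have current_zero : ∀ μ, ∀ x ∉ tsupport A, current m' h A Y μ x = 0 := fun μ x hx => by
    simp [current, image_eq_zero_of_notMem_tsupport hx]
  have current_contDiff : ∀ μ, ContDiff ℝ 1 (current m' h A Y μ) := fun μ =>
    contDiff_of_forall_mem_of_forall_notMem (isClosed_tsupport A)
      (fun x hx => contDiffAt_current m' (hd x hx) (hi x hx) hA.contDiffAt (hY x hx) μ)
      (current_zero μ)
  have current_compact : ∀ μ, HasCompactSupport (current m' h A Y μ) := fun μ =>
    HasCompactSupport.intro hc (current_zero μ)
  have tsupport_current : ∀ μ, tsupport (current m' h A Y μ) ⊆ tsupport A := fun μ =>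
    closure_minimal (fun x hx => by_contra fun hx' => hx (current_zero μ x hx'))
      (isClosed_tsupport A)
  rw [setIntegral_congr_fun (isClosed_tsupport A).measurableSet fun x hx =>
    (sum_fderiv_current hm' hadj (hd x hx) (hi x hx) (hA.differentiable one_ne_zero x)
      ((hY x hx).differentiableAt one_ne_zero)).symm,
    setIntegral_eq_integral_of_forall_compl_eq_zero,
    integral_finsetSum _ fun μ _ => integrable_fderiv_apply (current_contDiff μ)
      (current_compact μ) (gammaLow μ)]
  · exact Finset.sum_eq_zero fun μ _ => integral_fderiv_apply_eq_zero (current_contDiff μ)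
      (current_compact μ) (gammaLow μ)
  · refine fun x hx => Finset.sum_eq_zero fun μ _ => ?_
    have hxμ : x ∉ Function.support (fderiv ℝ (current m' h A Y μ)) := fun hx' =>
      hx (tsupport_current μ (support_fderiv_subset ℝ hx'))
    rw [Function.notMem_support.1 hxμ, _root_.zero_apply]

end CovDeriv

/-! ### Derivatives of the Lagrangian -/

theorem contDiffAt_multiformDeriv {E : Type*} [NormedAddCommGroup E] [NormedSpace ℝ E]
    {n : WithTop ℕ∞} (S : Finset ℕ) {f : E → Multiform → ℝ} {Z : E → Multiform} {x : E}
    (hf : ContDiffAt ℝ (n + 1) (Function.uncurry f) (x, Z x)) (hZ : ContDiffAt ℝ n Z x) :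
    ContDiffAt ℝ n (fun y => multiformDeriv S (f y) (Z y)) x := by
  refine ContDiffAt.sum fun I _ => ?_
  split_ifs
  · exact ((hf.fderiv hZ le_rfl).clm_apply contDiffAt_const).smul contDiffAt_const
  · exact contDiffAt_const

section Lagrangian

variable {n : WithTop ℕ∞} {S T : Finset ℕ} {Dstar : (Form1 → Multiform) → Form1 → Multiform}
  {l : Multiform × Multiform → ℝ} {X : Form1 → Multiform} {x : Form1}

theorem contDiffAt_derivFst (hl : ContDiffAt ℝ (n + 1) l (X x, Dstar X x))
    (hX : ContDiffAt ℝ n X x) (hDX : ContDiffAt ℝ n (Dstar X) x) :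
    ContDiffAt ℝ n (derivFst S Dstar l X) x := by
  have partial_contDiff : ContDiffAt ℝ n
      (fun p : Multiform × Multiform => multiformDeriv S (fun Z => l (Z, p.2)) p.1)
      (X x, Dstar X x) :=
    contDiffAt_multiformDeriv S
      (ContDiffAt.comp (g := l) _ hl (contDiffAt_snd.prodMk (contDiffAt_snd.comp _ contDiffAt_fst)))
      contDiffAt_fst
  exact ContDiffAt.comp (f := fun y => (X y, Dstar X y)) x partial_contDiff (hX.prodMk hDX)

theorem contDiffAt_derivSnd (hl : ContDiffAt ℝ (n + 1) l (X x, Dstar X x))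
    (hX : ContDiffAt ℝ n X x) (hDX : ContDiffAt ℝ n (Dstar X) x) :
    ContDiffAt ℝ n (derivSnd T Dstar l X) x := by
  have partial_contDiff : ContDiffAt ℝ n
      (fun p : Multiform × Multiform => multiformDeriv T (fun Z => l (p.1, Z)) p.2)
      (X x, Dstar X x) :=
    contDiffAt_multiformDeriv T
      (ContDiffAt.comp (g := l) _ hl ((contDiffAt_fst.comp _ contDiffAt_fst).prodMk contDiffAt_snd))
      contDiffAt_snd
  exact ContDiffAt.comp (f := fun y => (X y, Dstar X y)) x partial_contDiff (hX.prodMk hDX)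

theorem fderiv_apply_eq_scalarProd_derivFst_add (hl : DifferentiableAt ℝ l (X x, Dstar X x))
    {B C : Multiform} (hB : B ∈ gradeSpace S) (hC : C ∈ gradeSpace T) :
    fderiv ℝ l (X x, Dstar X x) (B, C) =
      scalarProd B (derivFst S Dstar l X x) + scalarProd C (derivSnd T Dstar l X x) := by
  rw [derivFst, derivSnd, scalarProd_multiformDeriv _ _ hB, scalarProd_multiformDeriv _ _ hC,
    fderiv_apply_prod hl]

end Lagrangian

/-! ### The Euler–Lagrange equation -/

/-- The left-hand side `∂_X ℓ - 𝒟*' ∂_{𝒟*X} ℓ` of the Euler–Lagrange equation, for the operators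
`𝒟*` and `𝒟*'` given by the products `m` and `m'` and for fields `X`, `𝒟*X` with grades in `S`
and `T`. -/
def eulerLagrange (S T : Finset ℕ) (m m' : Form1 →ₗ[ℝ] Multiform →ₗ[ℝ] Multiform)
    (h : Form1 → Form1 →L[ℝ] Form1) (l : Multiform × Multiform → ℝ) (X : Form1 → Multiform)
    (x : Form1) : Multiform :=
  derivFst S (covDeriv m h) l X x - covDeriv m' h (derivSnd T (covDeriv m h) l X) x

section EulerLagrange

variable {U : Set Form1} {h : Form1 → Form1 →L[ℝ] Form1} {S T : Finset ℕ}
  {A X : Form1 → Multiform} {l : Multiform × Multiform → ℝ}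
  {m m' : Form1 →ₗ[ℝ] Multiform →ₗ[ℝ] Multiform} {x : Form1}

theorem hasDerivAt_action (hU : MeasurableSet U) (hd : ∀ x ∈ U, ContDiffAt ℝ 1 h x)
    (hi : ∀ x ∈ U, (h x).IsInvertible) (hX : ∀ x ∈ U, ContDiffAt ℝ 1 X x)
    (hl : ∀ x ∈ U, ContDiffAt ℝ 1 l (X x, covDeriv m h X x))
    (hl_int : IntegrableOn (lagrangian h (covDeriv m h) l X) U) (hA : ContDiff ℝ 1 A)
    (hc : HasCompactSupport A) (hAU : tsupport A ⊆ U) :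
    HasDerivAt (fun t : ℝ => action U h (covDeriv m h) l (X + t • A))
      (∫ x in tsupport A, (h x).det *
        fderiv ℝ l (X x, covDeriv m h X x) (A x, covDeriv m h A x)) 0 := by
  have action_eq : (fun t : ℝ => action U h (covDeriv m h) l (X + t • A)) = fun t =>
      ∫ x in U, (h x).det • l ((X x, covDeriv m h X x) + t • (A x, covDeriv m h A x)) := by
    funext t
    refine setIntegral_congr_fun hU fun x hx => ?_
    simp only [lagrangian, covDeriv_add_smul ((hX x hx).differentiableAt one_ne_zero)
      (hA.differentiable one_ne_zero x)]
    rfl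
  have covDeriv_continuousAt : ∀ {Y : Form1 → Multiform}, ∀ x ∈ U, ContDiffAt ℝ 1 Y x →
      ContinuousAt (covDeriv m h Y) x := fun x hx hY =>
    (contDiffAt_covDeriv m (hd x hx) (hi x hx) hY (zero_add 1).le).continuousAt
  rw [action_eq]
  exact hasDerivAt_setIntegral_smul_comp_add_smul_of_subset hU hc hAU
    (fun x hx => (contDiffAt_det (hd x (hAU hx))).continuousAt.continuousWithinAt)
    (fun x hx => ((hX x (hAU hx)).continuousAt.prodMk
      (covDeriv_continuousAt x (hAU hx) (hX x (hAU hx)))).continuousWithinAt)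
    (fun x hx => (hA.continuous.continuousAt.prodMk
      (covDeriv_continuousAt x (hAU hx) hA.contDiffAt)).continuousWithinAt)
    (fun x hx => Prod.ext (image_eq_zero_of_notMem_tsupport (f := A) hx)
      (covDeriv_eq_zero_of_notMem_tsupport hx))
    (fun x hx => hl x (hAU hx)) hl_int

section Regularity

variable (hd : ContDiffAt ℝ 2 h x) (hi : (h x).IsInvertible) (hX : ContDiffAt ℝ 2 X x)
  (hl : ContDiffAt ℝ 2 l (X x, covDeriv m h X x))

include hd hi hX hl

theorem contDiffAt_derivFst_covDeriv : ContDiffAt ℝ 1 (derivFst S (covDeriv m h) l X) x :=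
  contDiffAt_derivFst (by rwa [one_add_one_eq_two]) (hX.of_le one_le_two)
    (contDiffAt_covDeriv m hd hi hX one_add_one_eq_two.le)

theorem contDiffAt_derivSnd_covDeriv : ContDiffAt ℝ 1 (derivSnd T (covDeriv m h) l X) x :=
  contDiffAt_derivSnd (by rwa [one_add_one_eq_two]) (hX.of_le one_le_two)
    (contDiffAt_covDeriv m hd hi hX one_add_one_eq_two.le)

theorem contDiffAt_zero_eulerLagrange : ContDiffAt ℝ 0 (eulerLagrange S T m m' h l X) x :=
  ((contDiffAt_derivFst_covDeriv hd hi hX hl).of_le zero_le_one).sub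
    (contDiffAt_covDeriv m' (hd.of_le one_le_two) hi (contDiffAt_derivSnd_covDeriv hd hi hX hl)
      (zero_add 1).le)

theorem eulerLagrange_mem_gradeSpace
    (hm' : ∀ a, Set.MapsTo (m' a) (gradeSpace T) (gradeSpace S)) :
    eulerLagrange S T m m' h l X x ∈ gradeSpace S :=
  Submodule.sub_mem _ (multiformDeriv_mem_gradeSpace _ _ _)
    (covDeriv_mem_gradeSpace hm' (hd.differentiableAt two_ne_zero) hi
      ((contDiffAt_derivSnd_covDeriv hd hi hX hl).differentiableAt one_ne_zero)
      fun _ => multiformDeriv_mem_gradeSpace _ _ _)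

end Regularity

section Stationary

variable (hd : ∀ x ∈ U, ContDiffAt ℝ 2 h x) (hi : ∀ x ∈ U, (h x).IsInvertible)
  (hX : ∀ x ∈ U, ContDiffAt ℝ 2 X x)
  (hl : ∀ x ∈ U, ContDiffAt ℝ 2 l (X x, covDeriv m h X x))
  (hm : ∀ a, Set.MapsTo (m a) (gradeSpace S) (gradeSpace T))
  (hm' : IsLorentzEquivariant m')
  (hadj : ∀ a, LinearMap.IsAdjointPair scalarProd scalarProd (m a) (m' a))

include hd hi hX hl hm hm' hadj

/-- Green's identity moves the derivative off the variation in the first variation of the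
action. -/
theorem setIntegral_fderiv_eq_setIntegral_eulerLagrange (hA : ContDiff ℝ 1 A)
    (hc : HasCompactSupport A) (hAU : tsupport A ⊆ U) (hAS : ∀ x, A x ∈ gradeSpace S) :
    ∫ x in tsupport A, (h x).det * fderiv ℝ l (X x, covDeriv m h X x) (A x, covDeriv m h A x) =
      ∫ x in tsupport A, (h x).det * scalarProd (A x) (eulerLagrange S T m m' h l X x) := by
  set Y := derivSnd T (covDeriv m h) l X
  have hd₁ : ∀ x ∈ tsupport A, ContDiffAt ℝ 1 h x := fun x hx => (hd x (hAU hx)).of_le one_le_two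
  have hi' : ∀ x ∈ tsupport A, (h x).IsInvertible := fun x hx => hi x (hAU hx)
  have hY : ∀ x ∈ tsupport A, ContDiffAt ℝ 1 Y x := fun x hx =>
    contDiffAt_derivSnd_covDeriv (hd x (hAU hx)) (hi' x hx) (hX x (hAU hx)) (hl x (hAU hx))
  have pointwise : ∀ x ∈ tsupport A,
      (h x).det * fderiv ℝ l (X x, covDeriv m h X x) (A x, covDeriv m h A x) =
        (h x).det * scalarProd (A x) (eulerLagrange S T m m' h l X x)
          + (h x).det * (scalarProd (covDeriv m h A x) (Y x)
            + scalarProd (A x) (covDeriv m' h Y x)) := fun x hx => by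
    rw [fderiv_apply_eq_scalarProd_derivFst_add ((hl x (hAU hx)).differentiableAt two_ne_zero)
      (hAS x) (covDeriv_mem_gradeSpace hm ((hd₁ x hx).differentiableAt one_ne_zero) (hi' x hx)
        (hA.differentiable one_ne_zero x) hAS), eulerLagrange, map_sub]
    ring
  have covDeriv_contDiffAt : ∀ {Z : Form1 → Multiform} (m), ∀ x ∈ tsupport A,
      ContDiffAt ℝ 1 Z x → ContDiffAt ℝ 0 (covDeriv m h Z) x := fun m x hx hZ =>
    contDiffAt_covDeriv m (hd₁ x hx) (hi' x hx) hZ (zero_add 1).le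
  have eulerLagrange_integrable : IntegrableOn (fun x => (h x).det *
      scalarProd (A x) (eulerLagrange S T m m' h l X x)) (tsupport A) :=
    ContinuousOn.integrableOn_compact hc fun x hx =>
      ((contDiffAt_det (hd₁ x hx)).continuousAt.mul (contDiffAt_bilinear scalarProd
        (hA.contDiffAt.of_le zero_le_one) (contDiffAt_zero_eulerLagrange
          (hd x (hAU hx)) (hi' x hx) (hX x (hAU hx)) (hl x (hAU hx)))).continuousAt
        ).continuousWithinAt
  have green_integrable : IntegrableOn (fun x => (h x).det * (scalarProd (covDeriv m h A x) (Y x)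
      + scalarProd (A x) (covDeriv m' h Y x))) (tsupport A) :=
    ContinuousOn.integrableOn_compact hc fun x hx =>
      ((contDiffAt_det (hd₁ x hx)).continuousAt.mul
        ((contDiffAt_bilinear scalarProd (covDeriv_contDiffAt m x hx hA.contDiffAt)
          ((hY x hx).of_le zero_le_one)).add
        (contDiffAt_bilinear scalarProd (hA.contDiffAt.of_le zero_le_one)
          (covDeriv_contDiffAt m' x hx (hY x hx)))).continuousAt).continuousWithinAt
  rw [setIntegral_congr_fun (isClosed_tsupport A).measurableSet pointwise,
    integral_add eulerLagrange_integrable green_integrable,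
    setIntegral_covDeriv_add_eq_zero hm' hadj hA hc hd₁ hi' hY, add_zero]

theorem gradePart_eulerLagrange_eq_zero (hU : IsOpen U)
    (hstat : IsStationary S U h (covDeriv m h) l X) (hx : x ∈ U) :
    gradePart S (eulerLagrange S T m m' h l X x) = 0 := by
  refine gradePart_eq_zero_iff.2 fun I hI => repr_eq_zero_of_scalarProd_blade_eq_zero ?_
  suffices Set.EqOn (fun x => (h x).det * scalarProd (blade I) (eulerLagrange S T m m' h l X x))
      0 U from (mul_eq_zero.1 (this hx)).resolve_left (det_ne_zero_of_isInvertible (hi x hx))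
  refine eqOn_zero_of_forall_integral_smul_eq_zero (μ := volume) hU (fun x hx => ?_)
    fun φ hφ hφc hφU => ?_
  · exact ((contDiffAt_det (hd x hx)).continuousAt.mul
      ((scalarProd (blade I)).continuous_of_finiteDimensional.continuousAt.comp
        (contDiffAt_zero_eulerLagrange (hd x hx) (hi x hx) (hX x hx) (hl x hx)).continuousAt)
      ).continuousWithinAt
  · set A : Form1 → Multiform := fun x => φ x • blade I
    have hA : ContDiff ℝ ∞ A := hφ.smul contDiff_const
    have hAS : ∀ x, A x ∈ gradeSpace S := fun x =>
      Submodule.smul_mem _ _ (blade_mem_gradeSpace hI)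
    have hAc : HasCompactSupport A := hφc.smul_right
    have hAU : tsupport A ⊆ U := (tsupport_smul_subset_left φ _).trans hφU
    have first_variation := hasDerivAt_action hU.measurableSet
      (fun x hx => (hd x hx).of_le one_le_two) hi (fun x hx => (hX x hx).of_le one_le_two)
      (fun x hx => (hl x hx).of_le one_le_two) hstat.1 (hA.of_le (by simp)) hAc hAU
    have weak_form := first_variation.unique
      (hstat.2 A hA (fun x => gradePart_eq_self_iff.2 (hAS x)) hAc hAU)
    rw [setIntegral_fderiv_eq_setIntegral_eulerLagrange hd hi hX hl hm hm' hadj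
      (hA.of_le (by simp)) hAc hAU hAS, setIntegral_eq_integral_of_forall_compl_eq_zero
      fun x hx => by simp [image_eq_zero_of_notMem_tsupport hx]] at weak_form
    simpa [A, mul_left_comm] using weak_form

theorem eulerLagrange_eq_zero (hm'S : ∀ a, Set.MapsTo (m' a) (gradeSpace T) (gradeSpace S))
    (hU : IsOpen U) (hstat : IsStationary S U h (covDeriv m h) l X) (hx : x ∈ U) :
    eulerLagrange S T m m' h l X x = 0 := by
  rw [← gradePart_eulerLagrange_eq_zero hd hi hX hl hm hm' hadj hU hstat hx, eq_comm,
    gradePart_eq_self_iff]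
  exact eulerLagrange_mem_gradeSpace (hd x hx) (hi x hx) (hX x hx) (hl x hx) hm'S

end Stationary

end EulerLagrange

end GaugeELE

end

theorem mainTheorem2_general
    (U : Set Form1) (hU : IsOpen U)
    (h : Form1 → Form1 →L[ℝ] Form1) (hh : ContDiffOn ℝ 2 h U)
    (hinv : ∀ x ∈ U, (h x).IsInvertible)
    (S : Finset ℕ)
    (X : Form1 → Multiform) (hX : ContDiffOn ℝ 2 X U)
    (l : Multiform × Multiform → ℝ) :
    ((∀ x ∈ U, ContDiffAt ℝ 2 l (X x, hDiv h X x)) → IsStationary S U h (hDiv h) l X →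
      ∀ x ∈ U, derivFst S (hDiv h) l X x
        - hCurl h (derivSnd (lowerGrades S) (hDiv h) l X) x = 0) ∧
    ((∀ x ∈ U, ContDiffAt ℝ 2 l (X x, hCurl h X x)) → IsStationary S U h (hCurl h) l X →
      ∀ x ∈ U, derivFst S (hCurl h) l X x
        - hDiv h (derivSnd (raiseGrades S) (hCurl h) l X) x = 0) ∧
    ((∀ x ∈ U, ContDiffAt ℝ 2 l (X x, hGrad h X x)) → IsStationary S U h (hGrad h) l X →
      (∀ x ∈ U, gradePart S (derivFst S (hGrad h) l X x
        - hGrad h (derivSnd (lowerGrades S ∪ raiseGrades S) (hGrad h) l X) x) = 0) ∧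
      ((∀ p ∈ S, ∀ q ∈ Finset.range 5, Even (p + q) → q ∈ S) →
        ∀ x ∈ U, derivFst S (hGrad h) l X x
          - hGrad h (derivSnd (lowerGrades S ∪ raiseGrades S) (hGrad h) l X) x = 0)) := by
  have hd := fun x hx => hh.contDiffAt (hU.mem_nhds (x := x) hx)
  have hXd := fun x hx => hX.contDiffAt (hU.mem_nhds (x := x) hx)
  rw [← covDeriv_contractL, ← covDeriv_wedgeL, ← covDeriv_mulL]
  refine ⟨fun hl hstat x hx => ?_, fun hl hstat x hx => ?_, fun hl hstat =>
    ⟨fun x hx => ?_, fun hpar x hx => ?_⟩⟩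
  · exact eulerLagrange_eq_zero hd hinv hXd hl (mapsTo_contractL_gradeSpace S)
      isLorentzEquivariant_wedgeL isAdjointPair_contractL_wedgeL
      (fun a _ hY => gradeSpace_mono (raiseGrades_lowerGrades_subset S)
        (mapsTo_wedgeL_gradeSpace _ a hY)) hU hstat hx
  · exact eulerLagrange_eq_zero hd hinv hXd hl (mapsTo_wedgeL_gradeSpace S)
      isLorentzEquivariant_contractL isAdjointPair_wedgeL_contractL
      (fun a _ hY => gradeSpace_mono (lowerGrades_raiseGrades_subset S)
        (mapsTo_contractL_gradeSpace _ a hY)) hU hstat hx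
  · exact gradePart_eulerLagrange_eq_zero hd hinv hXd hl (mapsTo_mulL_gradeSpace S)
      isLorentzEquivariant_mulL isAdjointPair_mulL hU hstat hx
  · exact eulerLagrange_eq_zero hd hinv hXd hl (mapsTo_mulL_gradeSpace S)
      isLorentzEquivariant_mulL isAdjointPair_mulL
      (fun a _ hY => gradeSpace_mono (lowerGrades_union_raiseGrades_subset hpar)
        (mapsTo_mulL_gradeSpace _ a hY)) hU hstat hx

theorem mainTheorem2
    (U : Set Form1) (hU : IsOpen U)
    (h : Form1 → Form1 →L[ℝ] Form1) (hh : ContDiffOn ℝ ∞ h U)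
    (hinv : ∀ x ∈ U, (h x).IsInvertible)
    (S : Finset ℕ) (hS : S ⊆ Finset.range 5)
    (X : Form1 → Multiform) (hX : ContDiffOn ℝ ∞ X U)
    (hXS : ∀ x ∈ U, gradePart S (X x) = X x)
    (l : Multiform × Multiform → ℝ) :
    ((∀ x ∈ U, ContDiffAt ℝ 2 l (X x, hDiv h X x)) → IsStationary S U h (hDiv h) l X →
      ∀ x ∈ U, derivFst S (hDiv h) l X x
        - hCurl h (derivSnd (lowerGrades S) (hDiv h) l X) x = 0) ∧
    ((∀ x ∈ U, ContDiffAt ℝ 2 l (X x, hCurl h X x)) → IsStationary S U h (hCurl h) l X →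
      ∀ x ∈ U, derivFst S (hCurl h) l X x
        - hDiv h (derivSnd (raiseGrades S) (hCurl h) l X) x = 0) ∧
    ((∀ x ∈ U, ContDiffAt ℝ 2 l (X x, hGrad h X x)) → IsStationary S U h (hGrad h) l X →
      (∀ x ∈ U, gradePart S (derivFst S (hGrad h) l X x
        - hGrad h (derivSnd (lowerGrades S ∪ raiseGrades S) (hGrad h) l X) x) = 0) ∧
      ((∀ p ∈ S, ∀ q ∈ Finset.range 5, Even (p + q) → q ∈ S) →
        ∀ x ∈ U, derivFst S (hGrad h) l X x
          - hGrad h (derivSnd (lowerGrades S ∪ raiseGrades S) (hGrad h) l X) x = 0)) := by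
  exact mainTheorem2_general U hU h (hh.of_le ENat.LEInfty.out) hinv S X
    (hX.of_le ENat.LEInfty.out) l
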